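/- For $r,d\in\mathbb N$ let $F=F(X_r)$ be the free group on $X_r=\{x_1,\dots,x_r\}$, let $F^{(d)}$ be its $d$-th derived subgroup ($F^{(0)}=F$), and let $S_{r,d}=F/F^{(d)}$ be the free solvable group of rank $r$ and class $d$. For $w\in F$, $|w|$ denotes the length of the reduced word $w$, and $\mathrm{code}(w)\in\{0,1\}^*$ is the concatenation of the codes of its letters $x_i^{\pm1}$, where a letter is encoded by a sign bit and the $\lceil\log_2 r\rceil$ binary digits of its index; so $|\mathrm{code}(w)|=|w|(\lceil\log_2 r\rceil+1)$. Algorithms are programs of a random access machine with logarithmic (bit) cost and an instruction that produces independent fair random bits. **Theorem.** There are constants $C,k\in\mathbb N$ such that for all $r,d\in\mathbb N$ there is a randomized algorithm that decides the word problem in $S_{r,d}$ in quasi-linear time, in the following sense. For every $w\in F(X_r)$, on input $\mathrm{code}(w)$: - for every outcome of the random bits, the algorithm stops with an answer Yes or No in time at most $C\,(n+1)\,\lfloor\log_2 (n+2)\rfloor^{k}$ with $n=|\mathrm{code}(w)|$; if $r\le |w|$, this holds with $n=|w|$ as well; - (a) if $w=1$ in $S_{r,d}$, then the algorithm answers Yes,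 for every outcome of the random bits (it is false-biased); - (b) if $w\neq 1$ in $S_{r,d}$, then the algorithm answers No with probability at least $\left(1-\frac1{|w|}\right)^{\log_3|w|}$ (where $0^0=1$). -/

import Mathlib

open MeasureTheory

/-- The free solvable group `S_{r,d} = F / F^{(d)}` of rank `r` and class `d`, where `F` is the free
group on `r` generators and `F^{(d)}` is its `d`-th derived subgroup (`F^{(0)} = F`). -/
abbrev FreeSolvableGroup (r d : ℕ) : Type :=
  FreeGroup (Fin r) ⧸ derivedSeries (FreeGroup (Fin r)) d

/-! ### Encoding of words by bit-strings -/

/-- The code of a letter `x_i^{±1}`: one bit for the sign, followed by the `⌈log₂ r⌉` binary digits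
of the index `i ∈ {0, …, r - 1}`. It is a bit-string of length `⌈log₂ r⌉ + 1`. -/
def letterCode {r : ℕ} (a : Fin r × Bool) : List Bool :=
  a.2 :: List.ofFn (fun j : Fin (Nat.clog 2 r) => Nat.testBit a.1.val j.val)

/-- The code of `w ∈ F(X_r)`: the concatenation of the codes of the letters of the reduced word
that represents `w`. -/
def wordCode {r : ℕ} (w : FreeGroup (Fin r)) : List Bool :=
  w.toWord.flatMap letterCode

/-! ### Random access machines with coin flips, with logarithmic (bit) cost -/

namespace RAM

/-- Instructions. Registers are indexed by natural numbers and hold natural numbers; `R[i]` denotes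
the content of register `i`. Labels are positions in the program. -/
inductive Instr : Type
  /-- `R[i] := c` -/
  | const (i c : ℕ)
  /-- `R[i] := R[j]` -/
  | copy (i j : ℕ)
  /-- `R[i] := R[j] + R[k]` -/
  | add (i j k : ℕ)
  /-- `R[i] := max (R[j] - R[k]) 0` -/
  | sub (i j k : ℕ)
  /-- `R[i] := R[j] * R[k]` -/
  | mul (i j k : ℕ)
  /-- indirect read: `R[i] := R[R[j]]` -/
  | load (i j : ℕ)
  /-- indirect write: `R[R[i]] := R[j]` -/
  | store (i j : ℕ)
  /-- go to the instruction with label `l` -/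
  | jump (l : ℕ)
  /-- go to the instruction with label `l` if `R[i] = 0` -/
  | jumpZero (i l : ℕ)
  /-- put the next bit of the input (`0` or `1`) into `R[i]`, or `2` at the end of the input -/
  | read (i : ℕ)
  /-- put a fresh random bit (`0` or `1`) into `R[i]` -/
  | flip (i : ℕ)
  /-- stop, with answer Yes (`true`) or No (`false`) -/
  | halt (b : Bool)

/-- A program is a finite list of instructions. -/
abbrev Program : Type := List Instr

/-- A configuration: program counter, registers, unread part of the input, and the random bits that
have not been used yet. -/
structure Config : Type where
  pc : ℕ
  reg : ℕ → ℕ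
  input : List Bool
  coins : ℕ → Bool

/-- The initial configuration: all registers are zero. -/
def init (x : List Bool) (ω : ℕ → Bool) : Config where
  pc := 0
  reg := fun _ => 0
  input := x
  coins := ω

/-- Write `v` into register `i` and pass to the next instruction. -/
def Config.write (c : Config) (i v : ℕ) : Config :=
  { c with pc := c.pc + 1, reg := Function.update c.reg i v }

/-- The effect of one instruction: an answer, or a new configuration. -/
def Instr.exec (c : Config) : Instr → Bool ⊕ Config
  | const i v => .inr (c.write i v)
  | copy i j => .inr (c.write i (c.reg j))
  | add i j k => .inr (c.write i (c.reg j + c.reg k))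
  | sub i j k => .inr (c.write i (c.reg j - c.reg k))
  | mul i j k => .inr (c.write i (c.reg j * c.reg k))
  | load i j => .inr (c.write i (c.reg (c.reg j)))
  | store i j => .inr (c.write (c.reg i) (c.reg j))
  | jump l => .inr { c with pc := l }
  | jumpZero i l => .inr { c with pc := if c.reg i = 0 then l else c.pc + 1 }
  | read i =>
    match c.input with
    | [] => .inr (c.write i 2)
    | b :: x => .inr { c.write i b.toNat with input := x }
  | flip i => .inr { c.write i (c.coins 0).toNat with coins := fun n => c.coins (n + 1) }
  | halt b => .inl b

/-- The cost of one instruction: `1` plus the bit-lengths (`Nat.size`) of the register indices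
involved and of the numbers handled. Multiplication is charged at the schoolbook rate, that is,
the product of the bit-lengths of the factors. -/
def Instr.cost (c : Config) : Instr → ℕ
  | const i v => 1 + i.size + v.size
  | copy i j => 1 + i.size + j.size + (c.reg j).size
  | add i j k => 1 + i.size + j.size + k.size + (c.reg j).size + (c.reg k).size
  | sub i j k => 1 + i.size + j.size + k.size + (c.reg j).size + (c.reg k).size
  | mul i j k =>
    1 + i.size + j.size + k.size + ((c.reg j).size + 1) * ((c.reg k).size + 1)
  | load i j => 1 + i.size + j.size + (c.reg j).size + (c.reg (c.reg j)).size
  | store i j => 1 + i.size + j.size + (c.reg i).size + (c.reg j).size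
  | jump _ => 1
  | jumpZero i _ => 1 + i.size + (c.reg i).size
  | read i => 1 + i.size
  | flip i => 1 + i.size
  | halt _ => 1

/-- `Halts P c b t`: started in configuration `c`, the program `P` stops with answer `b`, and the
total cost of the executed instructions is `t`. -/
inductive Halts (P : Program) : Config → Bool → ℕ → Prop
  | last {c : Config} {a : Instr} {b : Bool} :
      P[c.pc]? = some a → a.exec c = .inl b → Halts P c b (a.cost c)
  | step {c c' : Config} {a : Instr} {b : Bool} {t : ℕ} :
      P[c.pc]? = some a → a.exec c = .inr c' → Halts P c' b t → Halts P c b (a.cost c + t)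

/-- On input `x` and with random bits `ω`, the program `P` stops with answer `b`. -/
def Answers (P : Program) (x : List Bool) (ω : ℕ → Bool) (b : Bool) : Prop :=
  ∃ t, Halts P (init x ω) b t

/-- On input `x` and with random bits `ω`, the program `P` stops, at total cost at most `T`. -/
def RunsInTime (P : Program) (x : List Bool) (ω : ℕ → Bool) (T : ℕ) : Prop :=
  ∃ b, ∃ t ≤ T, Halts P (init x ω) b t

/-- The law of an infinite sequence of independent fair coin flips. -/
noncomputable def coinMeasure : Measure (ℕ → Bool) :=
  Measure.infinitePi fun _ => (PMF.uniformOfFintype Bool).toMeasure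

end RAM

/-- The quasi-linear function `C * n * (log n) ^ k`, shifted so that it is positive at `n = 0, 1`. -/
def quasiLinear (C k n : ℕ) : ℕ := C * (n + 1) * Nat.log 2 (n + 2) ^ k

/-!
The word problem in `F / F⁽ᵈ⁾` is solved by labelling the prefixes of the word `w`. After `i` rounds,
two prefixes should have equal labels if and only if they agree in `F / F⁽ⁱ⁾`; then `w` is trivial in
`F / F⁽ᵈ⁾` if and only if after `d` rounds the empty prefix and `w` have equal labels.

The step from `N = F⁽ⁱ⁾` to `[N, N] = F⁽ⁱ⁺¹⁾` rests on the fact that two words agree in `F / [N, N]` if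
and only if their paths in the Cayley graph of `F / N` have the same flow, that is, traverse each
edge the same algebraic number of times (`FreeGroup.flow_eq_iff`). The old labels identify the
vertices on the path of `w`, hence its edges, and each edge receives a random weight of `m` bits; the
new label of a prefix is the total weight of its flow. Equal flows always have equal weights, so
errors are one-sided (`RAM.Describes.labels_eq`). Different flows have equal weights with probability
at most `2⁻ᵐ`: once all other weights are fixed, at most one weight of an edge on which the flows
differ is bad (`RAM.coinMeasure_collision_le`). These bad events do not depend on the course of the
computation, because `m` coins are flipped at every position of the word in every round, even if the
edge has a weight already. With `m` about `4 log₂ |w|`, the union bound over all pairs of prefixes and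
all rounds gives the required success probability (`RAM.Describes.le_coinMeasure`).

A nontrivial element of `F⁽ⁱ⁾` has length at least `2ⁱ` (`FreeGroup.two_pow_le_length`), so that about
`log₂ |w|` rounds are enough even if `d` is larger. Each round handles each letter with `O(log |w|)`
operations on numbers whose bit-length is logarithmic in the length of the code of `w`, because the indirectly addressed registers, which are
initially zero, serve as a table for the weights. The generators, whose indices may be much larger
than `|w|`, are first renumbered by small numbers, by means of a trie.

The program is written in a small while-language, for which one proves bounds for the number of steps
and for the size of all values (`RAM.Wp`); compilation to the machine multiplies the number of steps
by a factor that is quadratic in the number of bits of the values (`RAM.Exec.reach`).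
-/

/-! ### A while-language with bounded values, compiled to the random access machine -/

namespace RAM

/-- The scalar variables of the word-problem program: `len` is the length of the word, `nodes` the
greatest number of a trie node, `2 ^ ell` the least power of two above `len`, `coinCount` the number
of coins for one weight, `shift` the distance of the label ranges of consecutive rounds, `stride` the
factor in the table index of an edge, `base` the label of the empty prefix, `levels` the number of
rounds that are left and `hash` the label under construction. -/
inductive Var
  | len | nodes | one | two | bit | flag | cur | idx | nxt
  | pow | ell | coinCount | shift | stride | base | levels
  | hash | pos | succ | old | new | letter | sign | src | val | rho | flips | todo
  deriving DecidableEq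

/-- The arrays of the word-problem program: the child table of the trie, the generators and the signs
of the letters of the word, the labels of its prefixes, and the weights of the edges. -/
inductive Arr
  | trie | letter | sign | label | table
  deriving DecidableEq

/-- The register that holds a scalar variable; registers `0` and `1` are scratch registers. -/
def Var.addr (x : Var) : ℕ := x.ctorIdx + 2

/-- Entry `k` of the array `A` is held in register `64 + 8 * k + A.num`. -/
def Arr.num (A : Arr) : ℕ := A.ctorIdx

theorem Var.addr_lt (x : Var) : x.addr < 64 := by cases x <;> decide

theorem Var.two_le_addr (x : Var) : 2 ≤ x.addr := Nat.le_add_left _ _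

theorem Var.addr_inj {x y : Var} (h : x.addr = y.addr) : x = y := by
  revert h; cases x <;> cases y <;> decide

theorem Arr.num_lt (A : Arr) : A.num < 8 := by cases A <;> decide

theorem Arr.num_inj {A A' : Arr} (h : A.num = A'.num) : A = A' := by
  revert h; cases A <;> cases A' <;> decide

/-- States of the while-language: scalars, arrays, unread input and unused random bits. -/
structure St where
  v : Var → ℕ
  a : Arr → ℕ → ℕ
  input : List Bool
  coins : ℕ → Bool

/-- Assignment to a scalar variable. -/
def St.set (s : St) (x : Var) (v : ℕ) : St := { s with v := Function.update s.v x v }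

/-- Assignment to an array entry. -/
def St.setArr (s : St) (A : Arr) (k v : ℕ) : St :=
  { s with a := Function.update s.a A (Function.update (s.a A) k v) }

/-- Elementary operations; `get x A y` is `x := A[y]` and `put A y x` is `A[y] := x`. -/
inductive Op
  | const (x : Var) (c : ℕ)
  | copy (x y : Var)
  | add (x y z : Var)
  | sub (x y z : Var)
  | mul (x y z : Var)
  | get (x : Var) (A : Arr) (y : Var)
  | put (A : Arr) (y x : Var)
  | read (x : Var)
  | flip (x : Var)

/-- The effect of an elementary operation. -/
def Op.eval : Op → St → St
  | const x c, s => s.set x c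
  | copy x y, s => s.set x (s.v y)
  | add x y z, s => s.set x (s.v y + s.v z)
  | sub x y z, s => s.set x (s.v y - s.v z)
  | mul x y z, s => s.set x (s.v y * s.v z)
  | get x A y, s => s.set x (s.a A (s.v y))
  | put A y x, s => s.setArr A (s.v y) (s.v x)
  | read x, s =>
    match s.input with
    | [] => s.set x 2
    | b :: l => { s.set x b.toNat with input := l }
  | flip x, s => { s.set x (s.coins 0).toNat with coins := fun n => s.coins (n + 1) }

/-- The value produced by the operation is at most `M`. For the operations that only move values
around this is a consequence of `St.Bdd`, and nothing is required. -/
def Op.ok (M : ℕ) : Op → St → Prop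
  | const _ c, _ => c ≤ M
  | add _ y z, s => s.v y + s.v z ≤ M
  | mul _ y z, s => s.v y * s.v z ≤ M
  | _, _ => True

/-- All values stored in the state are at most `M`. -/
def St.Bdd (M : ℕ) (s : St) : Prop := (∀ x, s.v x ≤ M) ∧ ∀ A k, s.a A k ≤ M

theorem St.Bdd.set {M : ℕ} {s : St} (h : s.Bdd M) (x : Var) {v : ℕ} (hv : v ≤ M) :
    (s.set x v).Bdd M := by
  refine ⟨fun y => ?_, h.2⟩
  by_cases hy : y = x
  · subst hy; simpa [St.set] using hv
  · simpa [St.set, hy] using h.1 y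

theorem St.Bdd.setArr {M : ℕ} {s : St} (h : s.Bdd M) (A : Arr) (k : ℕ) {v : ℕ} (hv : v ≤ M) :
    (s.setArr A k v).Bdd M := by
  refine ⟨h.1, fun A' k' => ?_⟩
  by_cases hA : A' = A
  · subst hA
    by_cases hk : k' = k
    · subst hk; simpa [St.setArr] using hv
    · simpa [St.setArr, hk] using h.2 A' k'
  · simpa [St.setArr, hA] using h.2 A' k'

theorem Op.bdd_eval {M : ℕ} (hM : 2 ≤ M) {o : Op} {s : St} (h : s.Bdd M) (ho : o.ok M s) :
    (o.eval s).Bdd M := by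
  have hb : ∀ b : Bool, b.toNat ≤ M := fun b => (Bool.toNat_le b).trans (by omega)
  cases o with
  | const x c => exact h.set x ho
  | copy x y => exact h.set x (h.1 y)
  | add x y z => exact h.set x ho
  | sub x y z => exact h.set x ((Nat.sub_le _ _).trans (h.1 y))
  | mul x y z => exact h.set x ho
  | get x A y => exact h.set x (h.2 _ _)
  | put A y x => exact h.setArr A _ (h.1 x)
  | read x =>
    unfold Op.eval
    dsimp only
    split
    · exact h.set x hM
    · exact h.set x (hb _)
  | flip x => exact h.set x (hb _)

/-- The machine code of an elementary operation. -/
def Op.code : Op → List Instr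
  | const x c => [.const x.addr c]
  | copy x y => [.copy x.addr y.addr]
  | add x y z => [.add x.addr y.addr z.addr]
  | sub x y z => [.sub x.addr y.addr z.addr]
  | mul x y z => [.mul x.addr y.addr z.addr]
  | get x A y => [.const 0 8, .mul 0 0 y.addr, .const 1 (64 + A.num), .add 0 0 1, .load x.addr 0]
  | put A y x => [.const 0 8, .mul 0 0 y.addr, .const 1 (64 + A.num), .add 0 0 1, .store 0 x.addr]
  | read x => [.read x.addr]
  | flip x => [.flip x.addr]

/-- The effect of a straight-line sequence of operations. -/
def evalAll : List Op → St → St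
  | [], s => s
  | o :: l, s => evalAll l (o.eval s)

/-- Every operation of the sequence produces a value that is at most `M`. -/
def okAll (M : ℕ) : List Op → St → Prop
  | [], _ => True
  | o :: l, s => o.ok M s ∧ okAll M l (o.eval s)

/-- Commands of the while-language. The test of `ite x` and `loop x` is `x ≠ 0`. -/
inductive Cmd
  | block (l : List Op)
  | seq (c₁ c₂ : Cmd)
  | ite (x : Var) (c₁ c₂ : Cmd)
  | loop (x : Var) (c : Cmd)

/-- `Exec M c s t s'`: the command `c` leads from `s` to `s'` in `t` steps, and all values that
occur are at most `M`. -/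
inductive Exec (M : ℕ) : Cmd → St → ℕ → St → Prop
  | block {l s} : okAll M l s → Exec M (.block l) s l.length (evalAll l s)
  | seq {c₁ c₂ s s' s'' t t'} : Exec M c₁ s t s' → Exec M c₂ s' t' s'' →
      Exec M (.seq c₁ c₂) s (t + t') s''
  | ite_pos {x c₁ c₂ s s' t} : s.v x ≠ 0 → Exec M c₁ s t s' → Exec M (.ite x c₁ c₂) s (t + 2) s'
  | ite_zero {x c₁ c₂ s s' t} : s.v x = 0 → Exec M c₂ s t s' → Exec M (.ite x c₁ c₂) s (t + 2) s'
  | loop_pos {x c s s' s'' t t'} : s.v x ≠ 0 → Exec M c s t s' → Exec M (.loop x c) s' t' s'' →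
      Exec M (.loop x c) s (t + t' + 2) s''
  | loop_zero {x c s} : s.v x = 0 → Exec M (.loop x c) s 1 s

/-- Length of the machine code of a command. -/
def Cmd.len : Cmd → ℕ
  | block l => (l.flatMap Op.code).length
  | seq c₁ c₂ => c₁.len + c₂.len
  | ite _ c₁ c₂ => c₁.len + c₂.len + 2
  | loop _ c => c.len + 2

/-- The machine code of a command that starts at label `o`. -/
def Cmd.compile : Cmd → ℕ → List Instr
  | block l, _ => l.flatMap Op.code
  | seq c₁ c₂, o => c₁.compile o ++ c₂.compile (o + c₁.len)
  | ite x c₁ c₂, o => Instr.jumpZero x.addr (o + c₁.len + 2) :: (c₁.compile (o + 1) ++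
      Instr.jump (o + c₁.len + c₂.len + 2) :: c₂.compile (o + c₁.len + 2))
  | loop x c, o => Instr.jumpZero x.addr (o + c.len + 2) :: (c.compile (o + 1) ++
      [Instr.jump o])

theorem Cmd.length_compile (c : Cmd) : ∀ o, (c.compile o).length = c.len := by
  induction c with
  | block l => intro o; rfl
  | seq c₁ c₂ h₁ h₂ => intro o; simp [Cmd.compile, Cmd.len, h₁, h₂]
  | ite x c₁ c₂ h₁ h₂ => intro o; simp [Cmd.compile, Cmd.len, h₁, h₂]; omega
  | loop x c h => intro o; simp [Cmd.compile, Cmd.len, h]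

/-- The program `P` contains the instructions `l` from label `o` on. -/
def CodeAt (P : Program) (o : ℕ) (l : List Instr) : Prop :=
  ∀ i a, l[i]? = some a → P[o + i]? = some a

theorem CodeAt.left {P : Program} {o : ℕ} {l l' : List Instr} (h : CodeAt P o (l ++ l')) :
    CodeAt P o l := fun i a hi => h i a (by
  rw [List.getElem?_append_left]
  · exact hi
  · exact (List.getElem?_eq_some_iff.1 hi).1)

theorem CodeAt.right {P : Program} {o : ℕ} {l l' : List Instr} (h : CodeAt P o (l ++ l')) :
    CodeAt P (o + l.length) l' := fun i a hi => by
  rw [add_assoc]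
  exact h _ a (by rw [List.getElem?_append_right (by omega)]; simpa using hi)

theorem CodeAt.head {P : Program} {o : ℕ} {a : Instr} {l : List Instr} (h : CodeAt P o (a :: l)) :
    P[o]? = some a := h 0 a rfl

theorem CodeAt.tail {P : Program} {o : ℕ} {a : Instr} {l : List Instr} (h : CodeAt P o (a :: l)) :
    CodeAt P (o + 1) l := fun i b hi => by
  rw [add_assoc, add_comm 1 i]; exact h (i + 1) b (by simpa using hi)

/-- The program `P` leads from `c` to `c'` at total cost at most `t`, stated as a property of all
halting computations that start in `c'`. -/
def Reach (P : Program) (c c' : Config) (t : ℕ) : Prop :=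
  ∀ b u, Halts P c' b u → ∃ u' ≤ t + u, Halts P c b u'

theorem Reach.refl (P : Program) (c : Config) : Reach P c c 0 :=
  fun _ u h => ⟨u, by omega, h⟩

theorem Reach.trans {P : Program} {c c' c'' : Config} {t t' : ℕ} (h : Reach P c c' t)
    (h' : Reach P c' c'' t') : Reach P c c'' (t + t') := fun b u hu => by
  obtain ⟨u₁, h₁, h₂⟩ := h' b u hu
  obtain ⟨u₂, h₃, h₄⟩ := h b u₁ h₂
  exact ⟨u₂, by omega, h₄⟩

theorem Reach.mono {P : Program} {c c' : Config} {t t' : ℕ} (h : Reach P c c' t) (ht : t ≤ t') :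
    Reach P c c' t' := fun b u hu => by
  obtain ⟨u₁, h₁, h₂⟩ := h b u hu
  exact ⟨u₁, by omega, h₂⟩

theorem Reach.single {P : Program} {c c' : Config} {a : Instr} (h : P[c.pc]? = some a)
    (he : a.exec c = .inr c') {t : ℕ} (ht : a.cost c ≤ t) : Reach P c c' t :=
  fun _ u hu => ⟨a.cost c + u, by omega, Halts.step h he hu⟩

/-- The configuration `c` of the machine represents the state `s` of the while-language. -/
structure Corr (s : St) (c : Config) : Prop where
  var : ∀ x : Var, c.reg x.addr = s.v x
  arr : ∀ (A : Arr) (k : ℕ), c.reg (64 + 8 * k + A.num) = s.a A k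
  input : c.input = s.input
  coins : c.coins = s.coins

/-- Writing to a scratch register is not visible. -/
theorem Corr.scratch {s : St} {c : Config} (h : Corr s c) {i : ℕ} (hi : i < 2) (v : ℕ) :
    Corr s (c.write i v) := by
  refine ⟨fun x => ?_, fun A k => ?_, h.input, h.coins⟩
  · have := x.two_le_addr
    simpa [Config.write, Function.update_of_ne (show x.addr ≠ i by omega)] using h.var x
  · simpa [Config.write, Function.update_of_ne (show 64 + 8 * k + A.num ≠ i by omega)] using h.arr A k

theorem Corr.set {s : St} {c : Config} (h : Corr s c) (x : Var) (v : ℕ) :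
    Corr (s.set x v) (c.write x.addr v) := by
  refine ⟨fun y => ?_, fun A k => ?_, h.input, h.coins⟩
  · by_cases hy : y = x
    · subst hy; simp [Config.write, St.set]
    · have : y.addr ≠ x.addr := fun h => hy (Var.addr_inj h)
      simpa [Config.write, St.set, hy, this] using h.var y
  · have := x.addr_lt
    simpa [Config.write, St.set, Function.update_of_ne (show 64 + 8 * k + A.num ≠ x.addr by omega)]
      using h.arr A k

theorem Corr.setArr {s : St} {c : Config} (h : Corr s c) (A : Arr) (k v : ℕ) :
    Corr (s.setArr A k v) (c.write (64 + 8 * k + A.num) v) := by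
  refine ⟨fun y => ?_, fun A' k' => ?_, h.input, h.coins⟩
  · have := y.addr_lt
    simpa [Config.write, St.setArr, Function.update_of_ne (show y.addr ≠ 64 + 8 * k + A.num by omega)]
      using h.var y
  · have h1 := A.num_lt
    have h2 := A'.num_lt
    by_cases hA : A' = A
    · subst hA
      by_cases hk : k' = k
      · subst hk; simp [Config.write, St.setArr]
      · simpa [Config.write, St.setArr, hk,
          Function.update_of_ne (show 64 + 8 * k' + A'.num ≠ 64 + 8 * k + A'.num by omega)]
          using h.arr A' k'
    · have h3 : A'.num ≠ A.num := fun h => hA (Arr.num_inj h)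
      simpa [Config.write, St.setArr, hA,
          Function.update_of_ne (show 64 + 8 * k' + A'.num ≠ 64 + 8 * k + A.num by omega)]
          using h.arr A' k'

/-- An upper bound for the cost of one elementary operation on values that are at most `M`. -/
def opCost (M : ℕ) : ℕ := 20 * (M.size + 9) ^ 2

theorem one_le_opCost (M : ℕ) : 1 ≤ opCost M := Nat.succ_le_of_lt (by unfold opCost; positivity)

/-- Five machine instructions, on numbers with at most `M.size + 8` bits, suffice for one elementary
operation. -/
theorem Op.reach {M : ℕ} (hM : 2 ≤ M) {P : Program} {o : Op} {s : St} {c : Config}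
    (hs : s.Bdd M) (ho : o.ok M s) (hc : Corr s c) (hP : CodeAt P c.pc o.code) :
    ∃ c', Corr (o.eval s) c' ∧ c'.pc = c.pc + o.code.length ∧ Reach P c c' (opCost M) := by
  have hx : ∀ x : Var, x.addr.size ≤ 6 := fun x => Nat.size_le.2 (x.addr_lt.trans_le (by norm_num))
  have hv : ∀ x : Var, (s.v x).size ≤ M.size := fun x => Nat.size_le_size (hs.1 x)
  have hv' : ∀ x : Var, (c.reg x.addr).size ≤ M.size := fun x => by rw [hc.var]; exact hv x
  have ha : ∀ A k, (s.a A k).size ≤ M.size := fun A k => Nat.size_le_size (hs.2 A k)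
  have hσ : 1 ≤ M.size := Nat.size_pos.2 (by omega)
  set σ := M.size with hσdef
  have hbound : ∀ n, n ≤ 4 * (σ + 9) ^ 2 → n ≤ opCost M := fun n hn => by
    unfold opCost; rw [← hσdef]; omega
  have h8 : Nat.size 8 = 4 := by decide
  have h0 : Nat.size 0 = 0 := Nat.size_zero
  have h1 : Nat.size 1 = 1 := Nat.size_one
  -- the computation of the address, shared by the two array operations
  have pre : ∀ (A : Arr) (y : Var) (l : List Instr), CodeAt P c.pc
      ([.const 0 8, .mul 0 0 y.addr, .const 1 (64 + A.num), .add 0 0 1] ++ l) →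
      ∃ c', Corr s c' ∧ c'.pc = c.pc + 4 ∧ c'.reg 0 = 64 + 8 * s.v y + A.num ∧
        Reach P c c' (16 * (σ + 9) ^ 2) ∧ CodeAt P c'.pc l := by
    intro A y l hl
    let c1 := c.write 0 8
    let c2 := c1.write 0 (8 * c1.reg y.addr)
    let c3 := c2.write 1 (64 + A.num)
    let c4 := c3.write 0 (8 * c1.reg y.addr + (64 + A.num))
    have e1 : Corr s c1 := hc.scratch (by norm_num) _
    have e2 : Corr s c2 := e1.scratch (by norm_num) _
    have e3 : Corr s c3 := e2.scratch (by norm_num) _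
    have e4 : Corr s c4 := e3.scratch (by norm_num) _
    have hA : (64 + A.num).size ≤ 7 := Nat.size_le.2 (by have := A.num_lt; omega)
    have h8v : (8 * s.v y).size ≤ σ + 3 := by
      rw [Nat.size_le, pow_add]
      have := Nat.size_le.1 (hv y)
      omega
    refine ⟨c4, e4, rfl, ?_, ?_, hl.right⟩
    · simp [c4, Config.write, e1.var]; ring
    · have r1 : Reach P c c1 (4 * (σ + 9) ^ 2) :=
        Reach.single hl.left.head rfl (by simp only [Instr.cost, h8, h0]; nlinarith)
      have r2 : Reach P c1 c2 (4 * (σ + 9) ^ 2) := by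
        refine Reach.single (a := .mul 0 0 y.addr) hl.left.tail.head ?_ ?_
        · simp [Instr.exec, c2, c1, Config.write]
        · have : c1.reg 0 = 8 := by simp [c1, Config.write]
          simp only [Instr.cost, this, h8, h0, e1.var]
          have := hv y; have := hx y
          nlinarith
      have r3 : Reach P c2 c3 (4 * (σ + 9) ^ 2) := by
        refine Reach.single (a := .const 1 (64 + A.num)) hl.left.tail.tail.head rfl ?_
        simp only [Instr.cost, h1]
        nlinarith
      have r4 : Reach P c3 c4 (4 * (σ + 9) ^ 2) := by
        refine Reach.single (a := .add 0 0 1) hl.left.tail.tail.tail.head ?_ ?_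
        · simp [Instr.exec, c4, c3, c2, Config.write]
        · have u1 : c3.reg 0 = 8 * s.v y := by simp [c3, c2, Config.write, e1.var]
          have u2 : c3.reg 1 = 64 + A.num := by simp [c3, Config.write]
          simp only [Instr.cost, u1, u2, h0, h1]
          nlinarith
      exact (((r1.trans r2).trans r3).trans r4).mono (by omega)
  have haddr : ∀ (A : Arr) (y : Var), (64 + 8 * s.v y + A.num).size ≤ σ + 8 := fun A y => by
    rw [Nat.size_le, pow_add]
    have := Nat.size_le.1 (hv y)
    have := A.num_lt
    have := Nat.one_le_two_pow (n := σ)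
    omega
  cases o with
  | const x k =>
    refine ⟨_, hc.set x k, rfl, Reach.single hP.head rfl (hbound _ ?_)⟩
    have := hx x
    have : k.size ≤ σ := Nat.size_le_size ho
    simp only [Instr.cost]; nlinarith
  | copy x y =>
    refine ⟨_, hc.set x (s.v y), rfl, Reach.single hP.head ?_ (hbound _ ?_)⟩
    · simp [Instr.exec, hc.var]
    have := hx x; have := hx y; have := hv' y
    simp only [Instr.cost]; nlinarith
  | add x y z =>
    refine ⟨_, hc.set x (s.v y + s.v z), rfl, Reach.single hP.head ?_ (hbound _ ?_)⟩
    · simp [Instr.exec, hc.var]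
    have := hx x; have := hx y; have := hv' y; have := hx z; have := hv' z
    simp only [Instr.cost]; nlinarith
  | sub x y z =>
    refine ⟨_, hc.set x (s.v y - s.v z), rfl, Reach.single hP.head ?_ (hbound _ ?_)⟩
    · simp [Instr.exec, hc.var]
    have := hx x; have := hx y; have := hv' y; have := hx z; have := hv' z
    simp only [Instr.cost]; nlinarith
  | mul x y z =>
    refine ⟨_, hc.set x (s.v y * s.v z), rfl, Reach.single hP.head ?_ (hbound _ ?_)⟩
    · simp [Instr.exec, hc.var]
    have := hx x; have := hx y; have := hv' y; have := hx z; have := hv' z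
    have := Nat.mul_le_mul (Nat.succ_le_succ (hv' y)) (Nat.succ_le_succ (hv' z))
    simp only [Instr.cost]; nlinarith
  | get x A y =>
    obtain ⟨c4, hc4, hpc, hr, h4, hl⟩ := pre A y [.load x.addr 0] hP
    refine ⟨_, hc4.set x (s.a A (s.v y)), ?_, (h4.trans (Reach.single (t := 4 * (σ + 9) ^ 2)
      hl.head ?_ ?_)).mono ?_⟩
    · simp [Config.write, Op.code, hpc]
    · simp [Instr.exec, hr, hc4.arr]
    · simp only [Instr.cost, hr, hc4.arr, h0]
      have := hx x; have := haddr A y; have := ha A (s.v y)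
      nlinarith
    · unfold opCost; rw [← hσdef]; omega
  | put A y x =>
    obtain ⟨c4, hc4, hpc, hr, h4, hl⟩ := pre A y [.store 0 x.addr] hP
    refine ⟨_, hc4.setArr A (s.v y) (s.v x), ?_, (h4.trans (Reach.single (t := 4 * (σ + 9) ^ 2)
      hl.head ?_ ?_)).mono ?_⟩
    · simp [Config.write, Op.code, hpc]
    · simp [Instr.exec, hr, hc4.var]
    · simp only [Instr.cost, hr, hc4.var, h0]
      have := hx x; have := haddr A y; have := hv x
      nlinarith
    · unfold opCost; rw [← hσdef]; omega
  | read x =>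
    have hcost : Instr.cost c (.read x.addr) ≤ opCost M := hbound _ (by
      have := hx x
      simp only [Instr.cost]; nlinarith)
    have hin := hc.input
    unfold Op.eval
    dsimp only
    split
    next h =>
      refine ⟨_, hc.set x 2, rfl, Reach.single hP.head ?_ hcost⟩
      simp [Instr.exec, hin, h]
    next b l h =>
      have e := hc.set x b.toNat
      refine ⟨{ c.write x.addr b.toNat with input := l }, ⟨e.var, e.arr, rfl, e.coins⟩, rfl,
        Reach.single hP.head ?_ hcost⟩
      simp [Instr.exec, hin, h]
  | flip x =>
    have e := hc.set x (s.coins 0).toNat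
    refine ⟨{ c.write x.addr (s.coins 0).toNat with coins := fun n => s.coins (n + 1) },
      ⟨e.var, e.arr, e.input, rfl⟩, rfl, Reach.single hP.head ?_ (hbound _ ?_)⟩
    · simp [Instr.exec, hc.coins]
    have := hx x
    simp only [Instr.cost]; nlinarith

theorem evalAll_reach {M : ℕ} (hM : 2 ≤ M) {P : Program} : ∀ {l : List Op} {s : St} {c : Config},
    s.Bdd M → okAll M l s → Corr s c → CodeAt P c.pc (l.flatMap Op.code) →
    (evalAll l s).Bdd M ∧ ∃ c', Corr (evalAll l s) c' ∧
      c'.pc = c.pc + (l.flatMap Op.code).length ∧ Reach P c c' (l.length * opCost M)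
  | [], s, c, hs, _, hc, _ => ⟨hs, c, hc, rfl, (Reach.refl P c).mono (Nat.zero_le _)⟩
  | o :: l, s, c, hs, ho, hc, hP => by
    rw [List.flatMap_cons] at hP
    obtain ⟨c1, h1, h2, h3⟩ := Op.reach hM hs ho.1 hc hP.left
    obtain ⟨h4, c2, h5, h6, h7⟩ := evalAll_reach hM (Op.bdd_eval hM hs ho.1) ho.2 h1
      (by rw [h2]; exact hP.right)
    refine ⟨h4, c2, h5, ?_, (h3.trans h7).mono ?_⟩
    · rw [h6, h2, List.flatMap_cons, List.length_append, add_assoc]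
    · rw [List.length_cons]; linarith

theorem jumpZero_cost {M : ℕ} {s : St} {c : Config} (hs : s.Bdd M) (hc : Corr s c) (x : Var)
    (l : ℕ) : Instr.cost c (.jumpZero x.addr l) ≤ opCost M := by
  have hx : x.addr.size ≤ 6 := Nat.size_le.2 (x.addr_lt.trans_le (by norm_num))
  have hv : (c.reg x.addr).size ≤ M.size := by rw [hc.var]; exact Nat.size_le_size (hs.1 x)
  unfold opCost
  simp only [Instr.cost]; nlinarith

/-- The machine code of a command simulates the command, at cost `opCost M` per step. -/
theorem Exec.reach {M : ℕ} (hM : 2 ≤ M) {P : Program} {cmd : Cmd} {s s' : St} {t : ℕ}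
    (h : Exec M cmd s t s') : ∀ {c : Config}, s.Bdd M → Corr s c →
    CodeAt P c.pc (cmd.compile c.pc) → s'.Bdd M ∧ ∃ c', Corr s' c' ∧
      c'.pc = c.pc + cmd.len ∧ Reach P c c' (t * opCost M) := by
  have hone : 1 ≤ opCost M := one_le_opCost M
  induction h with
  | block ho => intro c hs hc hP; exact evalAll_reach hM hs ho hc hP
  | @seq c₁ c₂ s s' s'' t t' _ _ ih₁ ih₂ =>
    intro c hs hc hP
    obtain ⟨hs', c1, h1, h2, h3⟩ := ih₁ hs hc hP.left
    have hr := hP.right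
    rw [Cmd.length_compile] at hr
    obtain ⟨hs'', c2, h4, h5, h6⟩ := ih₂ hs' h1 (by rw [h2]; exact hr)
    refine ⟨hs'', c2, h4, ?_, (h3.trans h6).mono ?_⟩
    · rw [h5, h2, Cmd.len, add_assoc]
    · linarith
  | @ite_pos x c₁ c₂ s s' t hx _ ih =>
    intro c hs hc hP
    have r1 : Reach P c { c with pc := c.pc + 1 } (opCost M) :=
      Reach.single hP.head (by simp [Instr.exec, hc.var, hx]) (jumpZero_cost hs hc _ _)
    have e1 : Corr s { c with pc := c.pc + 1 } := ⟨hc.var, hc.arr, hc.input, hc.coins⟩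
    obtain ⟨hs', c1, h1, h2, h3⟩ := ih hs e1 hP.tail.left
    have hr := hP.tail.right
    rw [Cmd.length_compile] at hr
    refine ⟨hs', { c1 with pc := c.pc + c₁.len + c₂.len + 2 },
      ⟨h1.var, h1.arr, h1.input, h1.coins⟩, ?_,
      ((r1.trans h3).trans (Reach.single (a := .jump (c.pc + c₁.len + c₂.len + 2)) (t := opCost M)
        (by rw [h2]; exact hr.head) rfl hone)).mono ?_⟩
    · simp only [Cmd.len]; omega
    · linarith
  | @ite_zero x c₁ c₂ s s' t hx _ ih =>
    intro c hs hc hP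
    have r1 : Reach P c { c with pc := c.pc + c₁.len + 2 } (opCost M) :=
      Reach.single hP.head (by simp [Instr.exec, hc.var, hx]) (jumpZero_cost hs hc _ _)
    have e1 : Corr s { c with pc := c.pc + c₁.len + 2 } := ⟨hc.var, hc.arr, hc.input, hc.coins⟩
    have hr := hP.tail.right.tail
    rw [Cmd.length_compile, show c.pc + 1 + c₁.len + 1 = c.pc + c₁.len + 2 by omega] at hr
    obtain ⟨hs', c1, h1, h2, h3⟩ := ih hs e1 hr
    refine ⟨hs', c1, h1, ?_, (r1.trans h3).mono ?_⟩
    · simp only [h2, Cmd.len]; omega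
    · linarith
  | @loop_pos x cmd s s' s'' t t' hx _ _ ih₁ ih₂ =>
    intro c hs hc hP
    have r1 : Reach P c { c with pc := c.pc + 1 } (opCost M) :=
      Reach.single hP.head (by simp [Instr.exec, hc.var, hx]) (jumpZero_cost hs hc _ _)
    have e1 : Corr s { c with pc := c.pc + 1 } := ⟨hc.var, hc.arr, hc.input, hc.coins⟩
    obtain ⟨hs', c1, h1, h2, h3⟩ := ih₁ hs e1 hP.tail.left
    have hr := hP.tail.right
    rw [Cmd.length_compile] at hr
    have r2 : Reach P c1 { c1 with pc := c.pc } (opCost M) :=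
      Reach.single (a := .jump c.pc) (by rw [h2]; exact hr.head) rfl hone
    obtain ⟨hs'', c2, h4, h5, h6⟩ := ih₂ (c := { c1 with pc := c.pc }) hs'
      ⟨h1.var, h1.arr, h1.input, h1.coins⟩ hP
    exact ⟨hs'', c2, h4, h5, (((r1.trans h3).trans r2).trans h6).mono (by linarith)⟩
  | @loop_zero x cmd s hx =>
    intro c hs hc hP
    exact ⟨hs, { c with pc := c.pc + cmd.len + 2 }, ⟨hc.var, hc.arr, hc.input, hc.coins⟩,
      by simp only [Cmd.len]; omega,
      Reach.single hP.head (by simp [Instr.exec, hc.var, hx])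
        (by rw [one_mul]; exact jumpZero_cost hs hc _ _)⟩

/-- The program that executes `cmd` and answers Yes if and only if finally `x = 0`. -/
def Cmd.program (cmd : Cmd) (x : Var) : Program :=
  cmd.compile 0 ++ [.jumpZero x.addr (cmd.len + 2), .halt false, .halt true]

/-- The initial state of the while-language: all variables and all array entries are zero. -/
def St.start (x : List Bool) (ω : ℕ → Bool) : St := ⟨fun _ => 0, fun _ _ => 0, x, ω⟩

theorem Exec.halts {M : ℕ} (hM : 2 ≤ M) {cmd : Cmd} {x : List Bool} {ω : ℕ → Bool} {t : ℕ}
    {s : St} (h : Exec M cmd (St.start x ω) t s) (y : Var) :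
    ∃ u ≤ (t + 2) * opCost M, Halts (cmd.program y) (RAM.init x ω) (decide (s.v y = 0)) u := by
  have hP : CodeAt (cmd.program y) 0 (cmd.program y) := fun i a hi => by rwa [zero_add]
  have hone : 1 ≤ opCost M := one_le_opCost M
  obtain ⟨hs, c, h1, h2, h3⟩ := h.reach hM (P := cmd.program y) (c := RAM.init x ω)
    ⟨fun _ => Nat.zero_le _, fun _ _ => Nat.zero_le _⟩ ⟨fun _ => rfl, fun _ _ => rfl, rfl, rfl⟩
    hP.left
  have hpc : c.pc = cmd.len := by rw [h2]; simp [RAM.init]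
  have hr := hP.right
  rw [Cmd.length_compile, zero_add] at hr
  have r1 : Reach (cmd.program y) c
      { c with pc := if s.v y = 0 then cmd.len + 2 else cmd.len + 1 } (opCost M) :=
    Reach.single (by rw [hpc]; exact hr.head) (by simp [Instr.exec, h1.var, hpc])
      (jumpZero_cost hs h1 _ _)
  have r2 : Halts (cmd.program y) { c with pc := if s.v y = 0 then cmd.len + 2 else cmd.len + 1 }
      (decide (s.v y = 0)) 1 := by
    by_cases h0 : s.v y = 0
    · exact Halts.last (a := .halt true) (by simpa [h0] using hr.tail.tail.head)
        (by simp [Instr.exec, h0])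
    · exact Halts.last (a := .halt false) (by simpa [h0] using hr.tail.head)
        (by simp [Instr.exec, h0])
  obtain ⟨u, hu, h⟩ := (h3.trans r1) _ _ r2
  exact ⟨u, by linarith, h⟩

/-- `Wp M c s t Q`: started in `s`, the command `c` ends after at most `t` steps in a state that
satisfies `Q`, and all values that occur are at most `M`. -/
def Wp (M : ℕ) (c : Cmd) (s : St) (t : ℕ) (Q : St → Prop) : Prop :=
  ∃ t' ≤ t, ∃ s', Exec M c s t' s' ∧ Q s'

section Wp

variable {M t t' : ℕ} {c c₁ c₂ : Cmd} {s : St} {x : Var} {Q R : St → Prop}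

theorem Wp.mono (h : Wp M c s t Q) (ht : t ≤ t') (hQ : ∀ s, Q s → R s) : Wp M c s t' R := by
  obtain ⟨u, hu, s', h1, h2⟩ := h
  exact ⟨u, hu.trans ht, s', h1, hQ _ h2⟩

theorem Wp.block {l : List Op} (hl : l.length ≤ t) (ho : okAll M l s) (hQ : Q (evalAll l s)) :
    Wp M (.block l) s t Q := ⟨_, hl, _, .block ho, hQ⟩

theorem Wp.seq (h : Wp M c₁ s t (fun s' => Wp M c₂ s' t' Q)) : Wp M (.seq c₁ c₂) s (t + t') Q := by
  obtain ⟨u, hu, s', h1, u', hu', s'', h2, h3⟩ := h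
  exact ⟨_, Nat.add_le_add hu hu', s'', .seq h1 h2, h3⟩

theorem Wp.ite (h₁ : s.v x ≠ 0 → Wp M c₁ s t Q) (h₂ : s.v x = 0 → Wp M c₂ s t Q) :
    Wp M (.ite x c₁ c₂) s (t + 2) Q := by
  by_cases hx : s.v x = 0
  · obtain ⟨u, hu, s', h1, h2⟩ := h₂ hx
    exact ⟨_, Nat.add_le_add_right hu 2, s', .ite_zero hx h1, h2⟩
  · obtain ⟨u, hu, s', h1, h2⟩ := h₁ hx
    exact ⟨_, Nat.add_le_add_right hu 2, s', .ite_pos hx h1, h2⟩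

/-- The rule for loops with a known number `n` of rounds: `I k` holds after `k` rounds. -/
theorem Wp.loop (n : ℕ) (I : ℕ → St → Prop)
    (hpos : ∀ k < n, ∀ s, I k s → s.v x ≠ 0 ∧ Wp M c s t (I (k + 1)))
    (hzero : ∀ s, I n s → s.v x = 0) (hs : I 0 s) :
    Wp M (.loop x c) s (n * (t + 2) + 1) (I n) := by
  suffices H : ∀ j k, k + j = n → ∀ s, I k s → Wp M (.loop x c) s (j * (t + 2) + 1) (I n) from
    H n 0 (Nat.zero_add n) s hs
  intro j
  induction j with
  | zero =>
    intro k hk s hs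
    have : k = n := by omega
    subst this
    exact ⟨1, by omega, s, .loop_zero (hzero s hs), hs⟩
  | succ j ih =>
    intro k hk s hs
    obtain ⟨hx, u, hu, s', h1, h2⟩ := hpos k (by omega) s hs
    obtain ⟨u', hu', s'', h3, h4⟩ := ih (k + 1) (by omega) s' h2
    exact ⟨_, by linarith, s'', .loop_pos hx h1 h3, h4⟩

end Wp

end RAM

/-! ### Flows in the Cayley graph of a quotient of a free group -/

namespace FreeGroup

open scoped commutatorElement

variable {α : Type*}

/-- The contribution of a letter, read at the vertex `g`, to a flow in the Cayley graph of `F / N`: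
the letter `x` traverses the edge `(g, x)` forwards, and `x⁻¹` traverses `(g x⁻¹, x)` backwards. -/
noncomputable def letterFlow (N : Subgroup (FreeGroup α)) (g : FreeGroup α) (a : α × Bool) :
    (FreeGroup α ⧸ N) × α →₀ ℤ :=
  if a.2 then Finsupp.single ((g : FreeGroup α ⧸ N), a.1) 1
  else Finsupp.single (((g * mk [a] : FreeGroup α) : FreeGroup α ⧸ N), a.1) (-1)

/-- The flow of the path that starts at the vertex `g` of the Cayley graph of `F / N` and is
labelled by the word `L`: each edge is mapped to the algebraic number of its traversals. -/
noncomputable def flow (N : Subgroup (FreeGroup α)) : FreeGroup α → List (α × Bool) →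
    ((FreeGroup α ⧸ N) × α →₀ ℤ)
  | _, [] => 0
  | g, a :: L => letterFlow N g a + flow N (g * mk [a]) L

theorem mk_cons (a : α × Bool) (L : List (α × Bool)) : mk (a :: L) = mk [a] * mk L := by
  rw [mul_mk]; rfl

theorem flow_append (N : Subgroup (FreeGroup α)) (L L' : List (α × Bool)) : ∀ g,
    flow N g (L ++ L') = flow N g L + flow N (g * mk L) L' := by
  induction L with
  | nil => intro g; rw [← one_eq_mk, mul_one, flow, zero_add, List.nil_append]
  | cons a L ih =>
    intro g
    rw [List.cons_append, flow, flow, ih, mk_cons a L, mul_assoc, add_assoc]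

theorem mk_single_mul_not (x : α) (b : Bool) : mk [(x, b)] * mk [(x, !b)] = 1 := by
  rw [mul_mk, one_eq_mk]; exact Quot.sound (Red.Step.not (L₁ := []) (L₂ := []))

theorem mk_single_not (x : α) (b : Bool) : mk [(x, !b)] = (mk [(x, b)])⁻¹ :=
  eq_inv_of_mul_eq_one_right (mk_single_mul_not x b)

theorem flow_cancel (N : Subgroup (FreeGroup α)) (g : FreeGroup α) (x : α) (b : Bool) :
    flow N g [(x, b), (x, !b)] = 0 := by
  cases b
  · simp only [flow, letterFlow, Bool.not_false, if_true, add_zero]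
    rw [if_neg (by simp), ← Finsupp.single_add]; simp
  · have : g * mk [(x, true)] * mk [(x, false)] = g := by
      rw [mul_assoc, show mk [(x, true)] * mk [(x, false)] = 1 from mk_single_mul_not x true, mul_one]
    simp only [flow, letterFlow, Bool.not_true, if_true, add_zero]
    rw [if_neg (by simp), this, ← Finsupp.single_add]; simp

theorem flow_red {N : Subgroup (FreeGroup α)} {L L' : List (α × Bool)} (h : Red L L')
    (g : FreeGroup α) : flow N g L = flow N g L' := by
  induction h with
  | refl => rfl
  | tail _ hs ih =>
    rw [ih]
    cases hs with
    | @not L₁ L₂ x b =>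
      rw [show L₁ ++ (x, b) :: (x, !b) :: L₂ = L₁ ++ ([(x, b), (x, !b)] ++ L₂) from rfl,
        flow_append, flow_append, flow_append, flow_cancel, zero_add]
      congr 2
      rw [show mk [(x, b), (x, !b)] = 1 from by
        rw [mk_cons]; exact mk_single_mul_not x b, mul_one]

variable [DecidableEq α]

theorem flow_congr {N : Subgroup (FreeGroup α)} {L L' : List (α × Bool)} (h : mk L = mk L')
    (g : FreeGroup α) : flow N g L = flow N g L' := by
  rw [flow_red (reduce.red (L := L)), flow_red (reduce.red (L := L')), reduce.sound h]

omit [DecidableEq α] in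
theorem flow_congr_left {N : Subgroup (FreeGroup α)} [N.Normal] (L : List (α × Bool)) :
    ∀ {g g' : FreeGroup α}, (g : FreeGroup α ⧸ N) = g' → flow N g L = flow N g' L := by
  induction L with
  | nil => intros; rfl
  | cons a L ih =>
    intro g g' h
    have h' : ((g * mk [a] : FreeGroup α) : FreeGroup α ⧸ N) = (g' * mk [a] : FreeGroup α) := by
      rw [QuotientGroup.mk_mul, QuotientGroup.mk_mul, h]
    rw [flow, flow, ih h', letterFlow, letterFlow, h, h']

/-- The flow of an element of a free group, as a function of its starting vertex. -/
noncomputable def flowOf (N : Subgroup (FreeGroup α)) (g w : FreeGroup α) :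
    (FreeGroup α ⧸ N) × α →₀ ℤ := flow N g w.toWord

theorem flow_eq_flowOf (N : Subgroup (FreeGroup α)) (g : FreeGroup α) (L : List (α × Bool)) :
    flow N g L = flowOf N g (mk L) := flow_congr (by rw [mk_toWord]) g

theorem flowOf_mul (N : Subgroup (FreeGroup α)) (g v w : FreeGroup α) :
    flowOf N g (v * w) = flowOf N g v + flowOf N (g * v) w := by
  conv_lhs => rw [← mk_toWord (x := v), ← mk_toWord (x := w), mul_mk, ← flow_eq_flowOf, flow_append,
    mk_toWord]
  rfl

/-- The elements of `N` with zero flow. -/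
noncomputable def zeroFlow (N : Subgroup (FreeGroup α)) [N.Normal] : Subgroup (FreeGroup α) where
  carrier := {w | w ∈ N ∧ flowOf N 1 w = 0}
  one_mem' := ⟨N.one_mem, by simp [flowOf, flow]⟩
  mul_mem' := by
    rintro v w ⟨hv, hv'⟩ ⟨hw, hw'⟩
    refine ⟨N.mul_mem hv hw, ?_⟩
    rw [flowOf_mul, hv', zero_add, one_mul, flowOf,
      flow_congr_left _ (g' := 1) ((QuotientGroup.eq_one_iff v).2 hv)]
    exact hw'
  inv_mem' := by
    rintro v ⟨hv, hv'⟩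
    refine ⟨N.inv_mem hv, ?_⟩
    have h := flowOf_mul N 1 v v⁻¹
    rw [mul_inv_cancel, hv', zero_add, one_mul, flowOf, flowOf,
      flow_congr_left (g := v) _ (g' := 1) ((QuotientGroup.eq_one_iff v).2 hv)] at h
    rw [flowOf, ← h]; simp [flow]

/-- On `N` the flow is a homomorphism to an abelian group, so commutators have zero flow. -/
theorem commutator_le_zeroFlow (N : Subgroup (FreeGroup α)) [N.Normal] : ⁅N, N⁆ ≤ zeroFlow N := by
  have key : ∀ v ∈ N, ∀ w, flowOf N 1 (v * w) = flowOf N 1 v + flowOf N 1 w := by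
    intro v hv w
    rw [flowOf_mul, one_mul]
    congr 1
    exact flow_congr_left _ (g' := 1) ((QuotientGroup.eq_one_iff v).2 hv)
  rw [Subgroup.commutator_le]
  intro v hv w hw
  have hc : ⁅v, w⁆ * (w * v) = v * w := by rw [commutatorElement_def]; group
  have hN : ⁅v, w⁆ ∈ N := by
    rw [commutatorElement_def]
    exact N.mul_mem (N.mul_mem (N.mul_mem hv hw) (N.inv_mem hv)) (N.inv_mem hw)
  refine ⟨hN, ?_⟩
  have h := key _ hN (w * v)
  rw [hc, key v hv, key w hw, add_comm (flowOf N 1 w)] at h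
  exact left_eq_add.1 (h.trans (add_comm _ _))

omit [DecidableEq α] in
/-- The boundary map of the Cayley graph recovers the end point of a path from its flow. -/
theorem mk_eq_of_flow_eq {N : Subgroup (FreeGroup α)} [N.Normal] {L L' : List (α × Bool)}
    (h : flow N 1 L = flow N 1 L') : (mk L : FreeGroup α ⧸ N) = mk L' := by
  let bd : ((FreeGroup α ⧸ N) × α →₀ ℤ) →+ (FreeGroup α ⧸ N →₀ ℤ) :=
    Finsupp.liftAddHom fun e => (zmultiplesHom _)
      (Finsupp.single (e.1 * (of e.2 : FreeGroup α)) (1 : ℤ) - Finsupp.single e.1 1)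
  have key : ∀ (L : List (α × Bool)) (g : FreeGroup α), bd (flow N g L) =
      Finsupp.single ((g * mk L : FreeGroup α) : FreeGroup α ⧸ N) 1 -
        Finsupp.single (g : FreeGroup α ⧸ N) 1 := by
    intro L
    induction L with
    | nil => intro g; simp [flow, ← one_eq_mk]
    | cons a L ih =>
      intro g
      rw [flow, map_add, ih, mk_cons a L, ← mul_assoc]
      have : bd (letterFlow N g a) = Finsupp.single ((g * mk [a] : FreeGroup α) : FreeGroup α ⧸ N) 1 -
          Finsupp.single (g : FreeGroup α ⧸ N) 1 := by
        obtain ⟨x, b⟩ := a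
        cases b
        · have e : g * mk [(x, false)] * of x = g := by
            rw [mul_assoc, of, show mk [(x, false)] * mk [(x, true)] = 1 from mk_single_mul_not x false, mul_one]
          simp only [letterFlow, Bool.false_eq_true, if_false, bd, Finsupp.liftAddHom_apply_single]
          rw [← QuotientGroup.mk_mul, e]
          simp
        · simp [letterFlow, bd, of]
      rw [this]; abel
  have h' := (key L 1).symm.trans ((congrArg bd h).trans (key L' 1))
  rw [sub_left_inj, one_mul, one_mul] at h'
  exact Finsupp.single_left_injective one_ne_zero h'

omit [DecidableEq α] in
/-- An edge of the Cayley graph determines an element of `N`, by means of a transversal of `N`. -/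
theorem out_mul_mul_out_inv_mem {N : Subgroup (FreeGroup α)} [N.Normal] (q q' : FreeGroup α ⧸ N)
    (w : FreeGroup α) (h : q * w = q') : q.out * w * q'.out⁻¹ ∈ N := by
  rw [← QuotientGroup.eq_one_iff, QuotientGroup.mk_mul, QuotientGroup.mk_mul, QuotientGroup.mk_inv,
    QuotientGroup.out_eq', QuotientGroup.out_eq', h, mul_inv_cancel]

/-- Two words have the same flow in the Cayley graph of `F / N` if and only if they represent the
same element of `F / [N, N]`. For "only if", a transversal yields a homomorphism from the group of
flows to the abelianization of `N` which, by telescoping, recovers words up to `[N, N]`. -/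
theorem flow_eq_iff {N : Subgroup (FreeGroup α)} [N.Normal] (L L' : List (α × Bool)) :
    flow N 1 L = flow N 1 L' ↔ (mk L : FreeGroup α ⧸ ⁅N, N⁆) = mk L' := by
  constructor
  · intro h
    have hq := mk_eq_of_flow_eq h
    let ψ : ((FreeGroup α ⧸ N) × α →₀ ℤ) →+ Additive (Abelianization N) :=
      Finsupp.liftAddHom fun e => (zmultiplesHom _) (Additive.ofMul (Abelianization.of
        (⟨_, out_mul_mul_out_inv_mem e.1 _ (of e.2) rfl⟩ : N)))
    have key : ∀ (L : List (α × Bool)) (g : FreeGroup α), ψ (flow N g L) =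
        Additive.ofMul (Abelianization.of
          (⟨_, out_mul_mul_out_inv_mem (g : FreeGroup α ⧸ N) _ (mk L) rfl⟩ : N)) := by
      intro L
      induction L with
      | nil =>
        intro g
        rw [flow, map_zero, ← ofMul_one, ← _root_.map_one Abelianization.of]
        congr 2
        ext1
        simp [← one_eq_mk]
      | cons a L ih =>
        intro g
        have : ψ (letterFlow N g a) = Additive.ofMul (Abelianization.of
          (⟨_, out_mul_mul_out_inv_mem (g : FreeGroup α ⧸ N) _ (mk [a]) rfl⟩ : N)) := by
          obtain ⟨x, b⟩ := a
          cases b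
          · have e : ((g * mk [(x, false)] : FreeGroup α) : FreeGroup α ⧸ N) * (of x : FreeGroup α) = g := by
              rw [← QuotientGroup.mk_mul, mul_assoc, of, show mk [(x, false)] * mk [(x, true)] = 1 from mk_single_mul_not x false, mul_one]
            simp only [letterFlow, Bool.false_eq_true, if_false, ψ, Finsupp.liftAddHom_apply_single]
            simp only [zmultiplesHom_apply, neg_smul, one_smul]
            rw [← ofMul_inv, ← _root_.map_inv]
            congr 2
            ext1
            simp only [Subgroup.coe_inv, e, mul_inv_rev, inv_inv, ← QuotientGroup.mk_mul]
            rw [of, ← mk_single_not x true, mul_assoc]; rfl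
          · simp only [letterFlow, if_true, ψ, Finsupp.liftAddHom_apply_single, zmultiplesHom_apply,
              one_smul]
            rfl
        rw [flow, map_add, ih, this, ← ofMul_mul, ← _root_.map_mul]
        congr 2
        ext1
        simp only [Subgroup.coe_mul, mk_cons a L, QuotientGroup.mk_mul, mul_assoc]
        group
    have h' := (key L 1).symm.trans ((congrArg ψ h).trans (key L' 1))
    have h'' := Additive.ofMul.injective h'
    rw [← inv_mul_eq_one, ← _root_.map_inv, ← _root_.map_mul, ← MonoidHom.mem_ker, Abelianization.ker_of] at h''
    have h3 := Subgroup.mem_map_of_mem N.subtype h''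
    rw [Subgroup.map_subtype_commutator] at h3
    rw [QuotientGroup.eq]
    simp only [Subgroup.coe_subtype, Subgroup.coe_mul, Subgroup.coe_inv, hq] at h3
    have hn : (⁅N, N⁆).Normal := Subgroup.commutator_normal N N
    have h4 := hn.conj_mem _ h3 (((1 : FreeGroup α) : FreeGroup α ⧸ N) * (mk L' : FreeGroup α)).out⁻¹
    convert h4 using 1
    group
  · intro h
    have hn : (⁅N, N⁆).Normal := Subgroup.commutator_normal N N
    have hc : mk L * (mk L')⁻¹ ∈ ⁅N, N⁆ := by
      have := hn.conj_mem _ (QuotientGroup.eq.1 h.symm) (mk L')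
      convert this using 1
      group
    rw [flow_eq_flowOf, flow_eq_flowOf, ← inv_mul_cancel_right (mk L) (mk L'), flowOf_mul,
      (commutator_le_zeroFlow N hc).2, zero_add, one_mul]
    exact flow_congr_left _ (g' := 1)
      ((QuotientGroup.eq_one_iff _).2 (commutator_le_zeroFlow N hc).1)

/-- A negative coefficient of a flow comes from an inverse letter. -/
theorem exists_of_flow_neg {N : Subgroup (FreeGroup α)} {e : (FreeGroup α ⧸ N) × α} :
    ∀ {L : List (α × Bool)} {g : FreeGroup α}, flow N g L e < 0 → ∃ U V x, L = U ++ (x, false) :: V ∧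
      e = (((g * mk U * mk [(x, false)] : FreeGroup α) : FreeGroup α ⧸ N), x)
  | [], g, h => by simp [flow] at h
  | (x, b) :: L, g, h => by
    by_cases h' : flow N (g * mk [(x, b)]) L e < 0
    · obtain ⟨U, V, y, h1, h2⟩ := exists_of_flow_neg h'
      exact ⟨(x, b) :: U, V, y, by rw [h1]; rfl, by rw [h2, mk_cons _ U, ← mul_assoc g]⟩
    · rw [flow, Finsupp.add_apply] at h
      have h2 : letterFlow N g (x, b) e < 0 := by omega
      cases b
      · refine ⟨[], L, x, rfl, ?_⟩
        by_contra he
        have : (((g * mk [(x, false)] : FreeGroup α) : FreeGroup α ⧸ N), x) ≠ e := by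
          rw [← one_eq_mk, mul_one] at he
          exact fun h => he h.symm
        simp [letterFlow, this] at h2
      · classical
        rw [letterFlow, if_pos rfl, Finsupp.single_apply] at h2
        split_ifs at h2 <;> omega

/-- A positive coefficient of a flow comes from a letter that is not inverted. -/
theorem exists_of_flow_pos {N : Subgroup (FreeGroup α)} {e : (FreeGroup α ⧸ N) × α} :
    ∀ {L : List (α × Bool)} {g : FreeGroup α}, 0 < flow N g L e → ∃ U V x, L = U ++ (x, true) :: V ∧
      e = (((g * mk U : FreeGroup α) : FreeGroup α ⧸ N), x)
  | [], g, h => by simp [flow] at h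
  | (x, b) :: L, g, h => by
    by_cases h' : 0 < flow N (g * mk [(x, b)]) L e
    · obtain ⟨U, V, y, h1, h2⟩ := exists_of_flow_pos h'
      exact ⟨(x, b) :: U, V, y, by rw [h1]; rfl, by rw [h2, mk_cons _ U, ← mul_assoc g]⟩
    · rw [flow, Finsupp.add_apply] at h
      have h2 : 0 < letterFlow N g (x, b) e := by omega
      cases b
      · classical
        rw [letterFlow, if_neg (by simp), Finsupp.single_apply] at h2
        split_ifs at h2 <;> omega
      · refine ⟨[], L, x, rfl, ?_⟩
        by_contra he
        have : ((g : FreeGroup α ⧸ N), x) ≠ e := by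
          rw [← one_eq_mk, mul_one] at he
          exact fun h => he h.symm
        simp [letterFlow, this] at h2

/-- In a word with zero flow, the edge traversed by the first letter is traversed again in the
opposite direction, and the path in between is closed. -/
theorem exists_of_flow_cons_eq_zero {N : Subgroup (FreeGroup α)} [N.Normal] {x : α} {b : Bool}
    {L : List (α × Bool)} (h : flow N 1 ((x, b) :: L) = 0) :
    ∃ U V, L = U ++ (x, !b) :: V ∧ mk U ∈ N := by
  rw [flow, one_mul] at h
  cases b
  · have h0 := DFunLike.congr_fun h (((mk [(x, false)] : FreeGroup α) : FreeGroup α ⧸ N), x)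
    simp only [letterFlow, one_mul, Bool.false_eq_true, if_false, Finsupp.add_apply,
      Finsupp.single_eq_same, Finsupp.coe_zero, Pi.zero_apply] at h0
    obtain ⟨U, V, y, h1, h2⟩ := exists_of_flow_pos (show 0 < flow N (mk [(x, false)]) L
      (((mk [(x, false)] : FreeGroup α) : FreeGroup α ⧸ N), x) by omega)
    obtain ⟨h3, rfl⟩ := Prod.mk.inj h2
    refine ⟨U, V, h1, ?_⟩
    rw [QuotientGroup.eq] at h3
    rwa [inv_mul_cancel_left] at h3
  · have h0 := DFunLike.congr_fun h (((1 : FreeGroup α) : FreeGroup α ⧸ N), x)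
    simp only [letterFlow, if_true, Finsupp.add_apply,
      Finsupp.single_eq_same, Finsupp.coe_zero, Pi.zero_apply] at h0
    obtain ⟨U, V, y, h1, h2⟩ := exists_of_flow_neg
      (show flow N (mk [(x, true)]) L (((1 : FreeGroup α) : FreeGroup α ⧸ N), x) < 0 by omega)
    obtain ⟨h3, rfl⟩ := Prod.mk.inj h2
    refine ⟨U, V, h1, ?_⟩
    have hn : N.Normal := inferInstance
    rw [eq_comm, QuotientGroup.mk_one, QuotientGroup.eq_one_iff,
      show mk [(x, false)] = (mk [(x, true)])⁻¹ from mk_single_not x true] at h3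
    have := hn.conj_mem _ h3 (mk [(x, true)])⁻¹
    convert this using 1
    group

/-- A nontrivial element of the `i`-th derived subgroup of a free group has length at least `2 ^ i`:
its first edge is cancelled later on, and the word splits into two shorter closed paths in the
Cayley graph of the previous quotient. -/
theorem two_pow_le_length (i : ℕ) : ∀ {L : List (α × Bool)}, IsReduced L → L ≠ [] →
    mk L ∈ derivedSeries (FreeGroup α) i → 2 ^ i ≤ L.length := by
  induction i with
  | zero => intro L _ h _; exact List.length_pos_iff.2 h
  | succ i ih =>
    suffices H : ∀ n, ∀ L : List (α × Bool), L.length = n → IsReduced L → L ≠ [] →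
        mk L ∈ derivedSeries (FreeGroup α) (i + 1) → 2 ^ (i + 1) ≤ L.length from
      fun {L} => H _ L rfl
    intro n
    induction n using Nat.strong_induction_on with
    | _ n ihn =>
    intro L hn hL hne hmem
    have hnor : (derivedSeries (FreeGroup α) i).Normal := derivedSeries_normal _ i
    have hnor' : (derivedSeries (FreeGroup α) (i + 1)).Normal := derivedSeries_normal _ _
    obtain _ | ⟨⟨x, b⟩, L⟩ := L
    · exact absurd rfl hne
    have h0 : flow (derivedSeries (FreeGroup α) i) 1 ((x, b) :: L) = 0 := by
      rw [show (0 : _ →₀ ℤ) = flow (derivedSeries (FreeGroup α) i) 1 [] from rfl, flow_eq_iff,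
        ← one_eq_mk, QuotientGroup.mk_one, QuotientGroup.eq_one_iff]
      exact hmem
    obtain ⟨U, V, rfl, hU⟩ := exists_of_flow_cons_eq_zero h0
    have hUred : IsReduced U := hL.infix ⟨[(x, b)], (x, !b) :: V, by simp⟩
    have hVred : IsReduced V := hL.infix ⟨(x, b) :: U ++ [(x, !b)], [], by simp⟩
    have hUne : U ≠ [] := by
      rintro rfl
      simp at hL
    have e : mk ((x, b) :: (U ++ (x, !b) :: V)) = mk [(x, b)] * mk U * (mk [(x, b)])⁻¹ * mk V := by
      rw [mk_cons, ← mul_mk, mk_cons (x, !b) V, mk_single_not]; group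
    have hlU := ih hUred hUne hU
    by_cases hV : V = []
    · subst hV
      have : mk U ∈ derivedSeries (FreeGroup α) (i + 1) := by
        have := hnor'.conj_mem _ hmem (mk [(x, b)])⁻¹
        rw [e, ← one_eq_mk] at this
        convert this using 1
        group
      have := ihn U.length (by rw [← hn]; simp) U rfl hUred hUne this
      simp only [List.length_cons, List.length_append]
      omega
    · have hV' : mk V ∈ derivedSeries (FreeGroup α) i := by
        have h1 := derivedSeries_antitone (FreeGroup α) (Nat.le_succ i) hmem
        rw [e] at h1
        exact (Subgroup.mul_mem_cancel_left _ (hnor.conj_mem _ hU _)).1 h1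
      have := ih hVred hV hV'
      simp only [List.length_cons, List.length_append, pow_succ]
      omega

end FreeGroup

/-! ### Blocks of independent fair coin flips -/

namespace RAM

/-- The number with binary digits `f 0, …, f (m - 1)`, the most significant digit first. -/
def bitsVal (f : ℕ → Bool) : ℕ → ℕ
  | 0 => 0
  | t + 1 => 2 * bitsVal f t + (f t).toNat

theorem bitsVal_lt (f : ℕ → Bool) (m : ℕ) : bitsVal f m < 2 ^ m := by
  induction m with
  | zero => simp [bitsVal]
  | succ t ih => rw [bitsVal, pow_succ]; have := Bool.toNat_lt (f t); omega

theorem bitsVal_inj {f f' : ℕ → Bool} {m : ℕ} (h : bitsVal f m = bitsVal f' m) :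
    ∀ t < m, f t = f' t := by
  induction m with
  | zero => intro t ht; omega
  | succ m ih =>
    simp only [bitsVal] at h
    have h1 := Bool.toNat_lt (f m)
    have h2 := Bool.toNat_lt (f' m)
    intro t ht
    obtain ht | rfl := Nat.lt_succ_iff_lt_or_eq.1 ht
    · exact ih (by omega) t ht
    · have h3 : (f t).toNat = (f' t).toNat := by omega
      cases hf : f t <;> cases hf' : f' t <;> simp_all

theorem bitsVal_congr {f f' : ℕ → Bool} {m : ℕ} (h : ∀ t < m, f t = f' t) :
    bitsVal f m = bitsVal f' m := by
  induction m with
  | zero => rfl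
  | succ m ih => simp only [bitsVal]; rw [ih fun t ht => h t (by omega), h m (by omega)]

/-- The random number given by the `q`-th block of `m` coins. -/
def blockVal (m : ℕ) (ω : ℕ → Bool) (q : ℕ) : ℕ := bitsVal (fun t => ω (q * m + t)) m

theorem measurable_blockVal (m q : ℕ) : Measurable fun ω => blockVal m ω q := by
  have h : ∀ k, Measurable fun ω : ℕ → Bool => bitsVal (fun t => ω (q * m + t)) k := by
    intro k
    induction k with
    | zero => exact measurable_const
    | succ k ih =>
      exact (ih.const_mul 2).add ((measurable_of_countable Bool.toNat).comp (measurable_pi_apply _))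
  exact h m

/-- Blocks are disjoint: coins outside the block `q` determine the values of all other blocks. -/
theorem blockVal_congr {m q q' : ℕ} (hq : q' ≠ q) {ω ω' : ℕ → Bool}
    (h : ∀ k, ¬(q * m ≤ k ∧ k < q * m + m) → ω k = ω' k) : blockVal m ω q' = blockVal m ω' q' := by
  refine bitsVal_congr fun t ht => h _ ?_
  rintro ⟨h1, h2⟩
  obtain hlt | hlt := lt_or_gt_of_ne hq
  · have := Nat.mul_le_mul_right m (Nat.succ_le_of_lt hlt)
    rw [Nat.succ_mul] at this
    omega
  · have := Nat.mul_le_mul_right m (Nat.succ_le_of_lt hlt)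
    rw [Nat.succ_mul] at this
    omega

instance : IsProbabilityMeasure coinMeasure := by unfold coinMeasure; infer_instance

/-- Flipping a fixed set of coins preserves the law of the coin flips. -/
theorem coinMeasure_map_xor (v : ℕ → Bool) :
    coinMeasure.map (fun ω k => xor (ω k) (v k)) = coinMeasure := by
  unfold coinMeasure
  rw [Measure.infinitePi_map_pi _ (f := fun k b => xor b (v k))
    (fun k => measurable_of_countable _)]
  congr 1
  funext k
  refine Measure.ext_of_singleton fun b => ?_
  rw [Measure.map_apply (measurable_of_countable _) (measurableSet_singleton b)]
  have : (fun c => xor c (v k)) ⁻¹' {b} = {xor b (v k)} := by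
    ext c
    cases b <;> cases c <;> cases v k <;> simp
  rw [this, PMF.toMeasure_apply_singleton _ _ (measurableSet_singleton _),
    PMF.toMeasure_apply_singleton _ _ (measurableSet_singleton _)]
  simp

/-- If the coins outside a block of length `m` leave at most one possibility for the block, then the
probability is at most `2⁻ᵐ`: the translates of `A` by the `2ᵐ` changes of the block are disjoint
and equally probable. -/
theorem coinMeasure_le_of_block {A : Set (ℕ → Bool)} (hA : MeasurableSet A) (o m : ℕ)
    (h : ∀ ω ∈ A, ∀ ω' ∈ A, (∀ k, ¬(o ≤ k ∧ k < o + m) → ω k = ω' k) →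
      ∀ k, o ≤ k ∧ k < o + m → ω k = ω' k) :
    coinMeasure.real A ≤ ((2 : ℝ) ^ m)⁻¹ := by
  let V : (Fin m → Bool) → ℕ → Bool := fun v k =>
    if hk : o ≤ k ∧ k < o + m then v ⟨k - o, by omega⟩ else false
  let T : (Fin m → Bool) → (ℕ → Bool) → (ℕ → Bool) := fun v ω k => xor (ω k) (V v k)
  have hT : ∀ v, Measurable (T v) := fun v => by
    refine measurable_pi_iff.2 fun k => ?_
    exact (measurable_of_countable fun b => xor b (V v k)).comp (measurable_pi_apply k)
  have hmeas : ∀ v, coinMeasure.real (T v ⁻¹' A) = coinMeasure.real A := fun v => by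
    rw [← map_measureReal_apply (hT v) hA]
    congr 1
    exact coinMeasure_map_xor (V v)
  have hdisj : Pairwise (Function.onFun Disjoint fun v => T v ⁻¹' A) := by
    intro u v huv
    rw [Function.onFun, Set.disjoint_left]
    intro ω hu hv
    apply huv
    funext t
    have := h _ hu _ hv (fun k hk => by simp [T, V, hk]) (o + t) ⟨by omega, by omega⟩
    simpa [T, V] using this
  have hsum := measureReal_iUnion_fintype (μ := coinMeasure) hdisj (fun v => hT v hA)
  simp only [hmeas, Finset.sum_const, Finset.card_univ, Fintype.card_fun, Fintype.card_bool,
    Fintype.card_fin, nsmul_eq_mul, Nat.cast_pow, Nat.cast_ofNat] at hsum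
  have h1 : coinMeasure.real (⋃ v, T v ⁻¹' A) ≤ 1 := measureReal_le_one
  rw [hsum] at h1
  rw [← one_div, le_div_iff₀' (by positivity)]
  exact h1

end RAM

/-! ### Labelling the prefixes of a word -/

namespace RAM

/-- The position of the initial vertex of the edge that is traversed by letter number `j`. -/
def srcPos (sg : ℕ → Bool) (j : ℕ) : ℕ := if sg j then j else j + 1

/-- The edge traversed by letter `j`, encoded by the label of its initial vertex and the number
of its generator. -/
def edgeKey (Z : ℕ) (g : ℕ → ℕ) (sg : ℕ → Bool) (lab : ℕ → ℕ) (j : ℕ) : ℕ :=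
  lab (srcPos sg j) * Z + g j

/-- The first letter that traverses the same edge as letter `j`. -/
def firstKey (Z : ℕ) (g : ℕ → ℕ) (sg : ℕ → Bool) (lab : ℕ → ℕ) (j : ℕ) : ℕ :=
  Nat.find (⟨j, rfl⟩ : ∃ j', edgeKey Z g sg lab j' = edgeKey Z g sg lab j)

/-- The new labels of the prefixes: starting from `B`, each traversal of an edge adds or subtracts
the positive random weight of the edge. The weight of an edge is the random number `ρ` of its first
occurrence, plus one. -/
def newLabel (Z : ℕ) (g : ℕ → ℕ) (sg : ℕ → Bool) (lab ρ : ℕ → ℕ) (B : ℕ) : ℕ → ℕ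
  | 0 => B
  | j + 1 => if sg j then newLabel Z g sg lab ρ B j + (ρ (firstKey Z g sg lab j) + 1)
      else newLabel Z g sg lab ρ B j - (ρ (firstKey Z g sg lab j) + 1)

/-- The labels after `i` rounds. The starting points `2 * W * i` keep the labels of different rounds
apart. -/
def labels (n m W Z : ℕ) (g : ℕ → ℕ) (sg : ℕ → Bool) (ω : ℕ → Bool) : ℕ → ℕ → ℕ
  | 0 => fun _ => 0
  | i + 1 => newLabel Z g sg (labels n m W Z g sg ω i) (fun j => blockVal m ω (i * n + j))
      (2 * W * (i + 1))

/-- The sign of a letter. -/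
def sgnInt (b : Bool) : ℤ := if b then 1 else -1

section

variable {Z : ℕ} {g : ℕ → ℕ} {sg : ℕ → Bool} {lab ρ : ℕ → ℕ} {B n Q : ℕ}

theorem firstKey_congr {j j' : ℕ} (h : edgeKey Z g sg lab j = edgeKey Z g sg lab j') :
    firstKey Z g sg lab j = firstKey Z g sg lab j' := by
  simp only [firstKey, h]

theorem edgeKey_firstKey (j : ℕ) :
    edgeKey Z g sg lab (firstKey Z g sg lab j) = edgeKey Z g sg lab j :=
  Nat.find_spec (⟨j, rfl⟩ : ∃ j', edgeKey Z g sg lab j' = edgeKey Z g sg lab j)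

theorem firstKey_le (j : ℕ) : firstKey Z g sg lab j ≤ j := Nat.find_min' _ rfl

theorem newLabel_bounds (hρ : ∀ j, ρ j < Q) (a : ℕ) :
    B ≤ newLabel Z g sg lab ρ B a + a * Q ∧ newLabel Z g sg lab ρ B a ≤ B + a * Q := by
  induction a with
  | zero => simp [newLabel]
  | succ a ih =>
    have := hρ (firstKey Z g sg lab a)
    rw [newLabel, Nat.succ_mul]
    split_ifs <;> omega

/-- The truncated subtractions in `newLabel` are proper subtractions. -/
theorem newLabel_cast (hρ : ∀ j, ρ j < Q) (hB : n * Q ≤ B) {a : ℕ} (ha : a ≤ n) :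
    (newLabel Z g sg lab ρ B a : ℤ) =
      B + ∑ j ∈ Finset.range a, sgnInt (sg j) * (ρ (firstKey Z g sg lab j) + 1 : ℤ) := by
  induction a with
  | zero => simp [newLabel]
  | succ a ih =>
    rw [Finset.sum_range_succ, ← add_assoc, ← ih (by omega), newLabel]
    have h1 := hρ (firstKey Z g sg lab a)
    have h2 := (newLabel_bounds (Z := Z) (g := g) (sg := sg) (lab := lab) (B := B) hρ a).1
    have h3 : (a + 1) * Q ≤ n * Q := Nat.mul_le_mul_right Q ha
    rw [Nat.succ_mul] at h3
    cases sg a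
    · rw [if_neg (by simp), Nat.cast_sub (by omega)]
      simp [sgnInt]; ring
    · simp [sgnInt]

end

end RAM

namespace FreeGroup

variable {α : Type*}

/-- Letter number `j` of the word `L` traverses the edge `e` of the Cayley graph of `F / N`. -/
def IsEdge (N : Subgroup (FreeGroup α)) (L : List (α × Bool)) (j : ℕ)
    (e : (FreeGroup α ⧸ N) × α) : Prop :=
  ∃ a, L[j]? = some a ∧
    e = (((mk (L.take (if a.2 then j else j + 1)) : FreeGroup α) : FreeGroup α ⧸ N), a.1)

theorem IsEdge.unique {N : Subgroup (FreeGroup α)} {L : List (α × Bool)} {j : ℕ}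
    {e e' : (FreeGroup α ⧸ N) × α} (h : IsEdge N L j e) (h' : IsEdge N L j e') : e = e' := by
  obtain ⟨a, h1, rfl⟩ := h
  obtain ⟨a', h1', rfl⟩ := h'
  obtain rfl := Option.some.inj (h1.symm.trans h1')
  rfl

theorem IsEdge.lt {N : Subgroup (FreeGroup α)} {L : List (α × Bool)} {j : ℕ}
    {e : (FreeGroup α ⧸ N) × α} (h : IsEdge N L j e) : j < L.length := by
  obtain ⟨a, h1, -⟩ := h
  exact (List.getElem?_eq_some_iff.1 h1).1

theorem flow_take_succ (N : Subgroup (FreeGroup α)) {L : List (α × Bool)} {j : ℕ} {a : α × Bool}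
    (h : L[j]? = some a) : ∃ e, IsEdge N L j e ∧
      flow N 1 (L.take (j + 1)) = flow N 1 (L.take j) + Finsupp.single e (RAM.sgnInt a.2) := by
  refine ⟨_, ⟨a, h, rfl⟩, ?_⟩
  have ht : L.take (j + 1) = L.take j ++ [a] := by rw [List.take_add_one, h]; rfl
  rw [ht, flow_append, one_mul]
  congr 1
  rw [flow, flow, add_zero, letterFlow, mul_mk, ← ht, RAM.sgnInt]
  split_ifs <;> rfl

theorem exists_isEdge_of_flow_ne_zero {N : Subgroup (FreeGroup α)} {L : List (α × Bool)} {a : ℕ}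
    (ha : a ≤ L.length) {e : (FreeGroup α ⧸ N) × α} (h : flow N 1 (L.take a) e ≠ 0) :
    ∃ j, IsEdge N L j e := by
  induction a with
  | zero => simp [flow] at h
  | succ a ih =>
    obtain ⟨e', he', hf⟩ := flow_take_succ N (List.getElem?_eq_getElem (show a < L.length by omega))
    by_cases hee : e = e'
    · exact ⟨a, hee ▸ he'⟩
    · refine ih (by omega) ?_
      rwa [hf, Finsupp.add_apply, Finsupp.single_eq_of_ne hee, add_zero] at h

/-- Evaluation of a weight function `V` on the flow of a prefix. -/
theorem linearCombination_flow (N : Subgroup (FreeGroup α)) {L : List (α × Bool)}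
    (V : (FreeGroup α ⧸ N) × α → ℤ) (s : ℕ → Bool) (v : ℕ → ℤ)
    (hs : ∀ j a, L[j]? = some a → s j = a.2) (hV : ∀ j e, IsEdge N L j e → V e = v j)
    {a : ℕ} (ha : a ≤ L.length) :
    Finsupp.linearCombination ℤ V (flow N 1 (L.take a)) =
      ∑ j ∈ Finset.range a, RAM.sgnInt (s j) * v j := by
  induction a with
  | zero => simp [flow]
  | succ a ih =>
    have hla := List.getElem?_eq_getElem (show a < L.length by omega)
    obtain ⟨e, he, hf⟩ := flow_take_succ N hla
    rw [hf, map_add, ih (by omega), Finset.sum_range_succ, Finsupp.linearCombination_single,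
      hs a _ hla, hV a e he, smul_eq_mul]

end FreeGroup

namespace RAM

open FreeGroup

variable {α : Type*}

/-- `g` and `sg` describe the letters of `L`: generators are numbered injectively by numbers below
`Z`, and `sg` gives the signs. -/
structure Describes (L : List (α × Bool)) (Z : ℕ) (g : ℕ → ℕ) (sg : ℕ → Bool) : Prop where
  sign : ∀ j a, L[j]? = some a → sg j = a.2
  lt : ∀ j < L.length, g j < Z
  letter : ∀ j j' a a', L[j]? = some a → L[j']? = some a' → (g j = g j' ↔ a.1 = a'.1)

/-- The key of an edge determines the label of the initial vertex and the number of the generator. -/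
theorem Describes.edgeKey_eq_iff {L : List (α × Bool)} {Z : ℕ} {g : ℕ → ℕ} {sg : ℕ → Bool}
    (hd : Describes L Z g sg) {lab : ℕ → ℕ} {j j' : ℕ} (hj : j < L.length) (hj' : j' < L.length) :
    edgeKey Z g sg lab j = edgeKey Z g sg lab j' ↔
      lab (srcPos sg j) = lab (srcPos sg j') ∧ g j = g j' := by
  have hZ := hd.lt j hj
  have hZ' := hd.lt j' hj'
  constructor
  · intro hk
    have hg : g j = g j' := by
      have := congrArg (· % Z) hk
      simpa [edgeKey, Nat.mul_add_mod', Nat.mod_eq_of_lt hZ, Nat.mod_eq_of_lt hZ'] using this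
    rw [edgeKey, edgeKey, hg, add_left_inj] at hk
    exact ⟨Nat.eq_of_mul_eq_mul_right (by omega) hk, hg⟩
  · rintro ⟨h1, h2⟩
    rw [edgeKey, edgeKey, h1, h2]

section

variable {N : Subgroup (FreeGroup α)} {L : List (α × Bool)} {Z : ℕ} {g : ℕ → ℕ} {sg : ℕ → Bool}
  {lab : ℕ → ℕ}

/-- If prefixes that agree in `F / N` have equal labels, then equal edges have equal keys. -/
theorem Describes.edgeKey_eq (hd : Describes L Z g sg)
    (hlab : ∀ a ≤ L.length, ∀ b ≤ L.length,
      ((FreeGroup.mk (L.take a) : FreeGroup α) : FreeGroup α ⧸ N) = FreeGroup.mk (L.take b) → lab a = lab b)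
    {j j' : ℕ} {e : (FreeGroup α ⧸ N) × α} (h : IsEdge N L j e) (h' : IsEdge N L j' e) :
    edgeKey Z g sg lab j = edgeKey Z g sg lab j' := by
  have hj := h.lt
  have hj' := h'.lt
  obtain ⟨a, h1, h2⟩ := h
  obtain ⟨a', h1', h2'⟩ := h'
  obtain ⟨h3, h4⟩ := Prod.mk.inj (h2.symm.trans h2')
  have h5 := (hd.letter j j' a a' h1 h1').2 h4
  rw [edgeKey, edgeKey, h5, srcPos, srcPos, hd.sign j a h1, hd.sign j' a' h1']
  congr 2
  exact hlab _ (by split_ifs <;> omega) _ (by split_ifs <;> omega) h3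

/-- If prefixes with equal labels agree in `F / N`, then letters with equal keys traverse the same
edge. -/
theorem Describes.isEdge_of_edgeKey_eq (hd : Describes L Z g sg)
    (hlab : ∀ a ≤ L.length, ∀ b ≤ L.length, lab a = lab b →
      ((FreeGroup.mk (L.take a) : FreeGroup α) : FreeGroup α ⧸ N) = FreeGroup.mk (L.take b))
    {j j' : ℕ} (hj' : j' < L.length) {e : (FreeGroup α ⧸ N) × α} (h : IsEdge N L j e)
    (hk : edgeKey Z g sg lab j = edgeKey Z g sg lab j') : IsEdge N L j' e := by
  have hj := h.lt
  obtain ⟨a, h1, rfl⟩ := h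
  have h1' := List.getElem?_eq_getElem hj'
  obtain ⟨hl, hg⟩ := (hd.edgeKey_eq_iff hj hj').1 hk
  rw [srcPos, srcPos, hd.sign j a h1, hd.sign j' _ h1'] at hl
  refine ⟨_, h1', ?_⟩
  rw [(hd.letter j j' _ _ h1 h1').1 hg,
    hlab _ (by split_ifs <;> omega) _ (by split_ifs <;> omega) hl]

/-- One round never separates prefixes that agree in `F / [N, N]`: the new labels are a function of
the flow. -/
theorem Describes.newLabel_eq [DecidableEq α] [N.Normal] (hd : Describes L Z g sg)
    {ρ : ℕ → ℕ} {B Q : ℕ} (hρ : ∀ j, ρ j < Q) (hB : L.length * Q ≤ B)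
    (hlab : ∀ a ≤ L.length, ∀ b ≤ L.length,
      ((FreeGroup.mk (L.take a) : FreeGroup α) : FreeGroup α ⧸ N) = FreeGroup.mk (L.take b) → lab a = lab b)
    {a b : ℕ} (ha : a ≤ L.length) (hb : b ≤ L.length)
    (h : ((FreeGroup.mk (L.take a) : FreeGroup α) : FreeGroup α ⧸ ⁅N, N⁆) = FreeGroup.mk (L.take b)) :
    newLabel Z g sg lab ρ B a = newLabel Z g sg lab ρ B b := by
  classical
  let V : (FreeGroup α ⧸ N) × α → ℤ := fun e =>
    if h : ∃ j, IsEdge N L j e then (ρ (firstKey Z g sg lab h.choose) + 1 : ℤ) else 0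
  have hV : ∀ j e, IsEdge N L j e → V e = (ρ (firstKey Z g sg lab j) + 1 : ℤ) := by
    intro j e hj
    have hex : ∃ j, IsEdge N L j e := ⟨j, hj⟩
    simp only [V, dif_pos hex]
    rw [firstKey_congr (hd.edgeKey_eq hlab hex.choose_spec hj)]
  have h1 := linearCombination_flow N V sg _ hd.sign hV ha
  have h2 := linearCombination_flow N V sg _ hd.sign hV hb
  rw [(flow_eq_iff _ _).2 h] at h1
  rw [← Nat.cast_inj (R := ℤ), newLabel_cast hρ hB ha, newLabel_cast hρ hB hb, ← h1, ← h2]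

/-- The weights of the edges, given by the random numbers of the first occurrences. -/
noncomputable def edgeWeight (N : Subgroup (FreeGroup α)) (L : List (α × Bool)) (ρ : ℕ → ℕ)
    (e : (FreeGroup α ⧸ N) × α) : ℤ := ρ (sInf {j | IsEdge N L j e}) + 1

/-- If the old labels separate exactly the classes modulo `N`, then the new label is the weight of
the flow. -/
theorem Describes.newLabel_eq_linearCombination (hd : Describes L Z g sg)
    {ρ : ℕ → ℕ} {B Q : ℕ} (hρ : ∀ j, ρ j < Q) (hB : L.length * Q ≤ B)
    (hlab : ∀ a ≤ L.length, ∀ b ≤ L.length,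
      (lab a = lab b ↔ ((FreeGroup.mk (L.take a) : FreeGroup α) : FreeGroup α ⧸ N) = FreeGroup.mk (L.take b)))
    {a : ℕ} (ha : a ≤ L.length) :
    (newLabel Z g sg lab ρ B a : ℤ) =
      B + Finsupp.linearCombination ℤ (edgeWeight N L ρ) (flow N 1 (L.take a)) := by
  rw [newLabel_cast hρ hB ha, linearCombination_flow N _ sg
    (fun j => (ρ (firstKey Z g sg lab j) + 1 : ℤ)) hd.sign ?_ ha]
  intro j e hj
  rw [edgeWeight]
  congr 3
  apply le_antisymm
  · refine Nat.sInf_le ?_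
    exact hd.isEdge_of_edgeKey_eq (fun a ha b hb => (hlab a ha b hb).1)
      ((firstKey_le j).trans_lt hj.lt) hj (edgeKey_firstKey j).symm
  · refine Nat.find_min' _ ?_
    exact hd.edgeKey_eq (fun a ha b hb => (hlab a ha b hb).2)
      (Nat.sInf_mem (s := {j | IsEdge N L j e}) ⟨j, hj⟩) hj

end

/-- The bad event for the prefixes of lengths `a` and `b` in round `i`: their flows receive the same
weight. -/
def collision (N : Subgroup (FreeGroup α)) (L : List (α × Bool)) (m i a b : ℕ) :
    Set (ℕ → Bool) :=
  {ω | Finsupp.linearCombination ℤ (edgeWeight N L fun j => blockVal m ω (i * L.length + j))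
    (flow N 1 (L.take a) - flow N 1 (L.take b)) = 0}

/-- Different flows collide with probability at most `2⁻ᵐ`: an edge on which they differ has a
weight that is independent of the other weights. -/
theorem coinMeasure_collision_le {N : Subgroup (FreeGroup α)} {L : List (α × Bool)} (m i : ℕ)
    {a b : ℕ} (ha : a ≤ L.length) (hb : b ≤ L.length)
    (h : flow N 1 (L.take a) ≠ flow N 1 (L.take b)) :
    coinMeasure.real (collision N L m i a b) ≤ ((2 : ℝ) ^ m)⁻¹ := by
  set φ := flow N 1 (L.take a) - flow N 1 (L.take b) with hφ
  have hex : ∀ e, φ e ≠ 0 → ∃ j, IsEdge N L j e := by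
    intro e he
    by_cases h1 : flow N 1 (L.take a) e = 0
    · refine exists_isEdge_of_flow_ne_zero hb fun h2 => he ?_
      rw [hφ, Finsupp.sub_apply, h1, h2, sub_zero]
    · exact exists_isEdge_of_flow_ne_zero ha h1
  obtain ⟨e₀, he₀⟩ : ∃ e, φ e ≠ 0 := by
    by_contra hne
    push Not at hne
    exact h (sub_eq_zero.1 (Finsupp.ext hne))
  have hmem : ∀ e, φ e ≠ 0 → IsEdge N L (sInf {j | IsEdge N L j e}) e :=
    fun e he => Nat.sInf_mem (s := {j | IsEdge N L j e}) (hex e he)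
  set j₀ := sInf {j | IsEdge N L j e₀} with hj₀
  refine coinMeasure_le_of_block ?_ ((i * L.length + j₀) * m) m ?_
  · have hm : Measurable fun ω => Finsupp.linearCombination ℤ
        (edgeWeight N L fun j => blockVal m ω (i * L.length + j)) φ := by
      simp only [Finsupp.linearCombination_apply, Finsupp.sum, edgeWeight]
      refine Finset.measurable_sum _ fun e _ => ?_
      exact (measurable_of_countable fun k : ℕ => φ e • ((k : ℤ) + 1)).comp
        (measurable_blockVal m _)
    exact hm (measurableSet_singleton 0)
  · intro ω hω ω' hω' hout k hk
    have key : φ e₀ * (edgeWeight N L (fun j => blockVal m ω (i * L.length + j)) e₀ -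
        edgeWeight N L (fun j => blockVal m ω' (i * L.length + j)) e₀) = 0 := by
      have h0 := sub_eq_zero.2 (hω.trans hω'.symm)
      rw [Finsupp.linearCombination_apply, Finsupp.linearCombination_apply, Finsupp.sum,
        Finsupp.sum, ← Finset.sum_sub_distrib, Finset.sum_eq_single e₀] at h0
      · rw [← h0, smul_eq_mul, smul_eq_mul, mul_sub]
      · intro e he hne
        have hj : sInf {j | IsEdge N L j e} ≠ j₀ := fun hj =>
          hne (by
            have h1 := hmem e (Finsupp.mem_support_iff.1 he)
            rw [hj] at h1
            exact h1.unique (hmem e₀ he₀))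
        rw [edgeWeight, edgeWeight, blockVal_congr (q := i * L.length + j₀) (by omega) hout, sub_self]
      · intro he
        exact absurd (Finsupp.mem_support_iff.2 he₀) he
    rcases mul_eq_zero.1 key with h1 | h1
    · exact absurd h1 he₀
    · simp only [edgeWeight, add_sub_add_right_eq_sub, sub_eq_zero, Nat.cast_inj] at h1
      have := bitsVal_inj h1 (k - (i * L.length + j₀) * m) (by omega)
      rwa [← hj₀, show (i * L.length + j₀) * m + (k - (i * L.length + j₀) * m) = k by omega] at this

section

variable [DecidableEq α] {L : List (α × Bool)} {m W Z : ℕ} {g : ℕ → ℕ} {sg : ℕ → Bool}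

omit [DecidableEq α] in
/-- The labels do not depend on the numbering of the generators. -/
theorem Describes.labels_congr {Z' : ℕ} {g' : ℕ → ℕ} {sg' : ℕ → Bool} (hd : Describes L Z g sg)
    (hd' : Describes L Z' g' sg') (ω : ℕ → Bool) (i : ℕ) : ∀ a ≤ L.length,
      labels L.length m W Z g sg ω i a = labels L.length m W Z' g' sg' ω i a := by
  induction i with
  | zero => intros; rfl
  | succ i ih =>
    have hsg : ∀ j < L.length, sg j = sg' j := fun j hj => by
      rw [hd.sign j _ (List.getElem?_eq_getElem hj), hd'.sign j _ (List.getElem?_eq_getElem hj)]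
    have hsrc : ∀ j < L.length, srcPos sg j = srcPos sg' j ∧ srcPos sg j ≤ L.length :=
      fun j hj => ⟨by rw [srcPos, srcPos, hsg j hj], by rw [srcPos]; split_ifs <;> omega⟩
    have hkey : ∀ j < L.length, ∀ j' < L.length,
        (edgeKey Z g sg (labels L.length m W Z g sg ω i) j' =
          edgeKey Z g sg (labels L.length m W Z g sg ω i) j ↔
        edgeKey Z' g' sg' (labels L.length m W Z' g' sg' ω i) j' =
          edgeKey Z' g' sg' (labels L.length m W Z' g' sg' ω i) j) := by
      intro j hj j' hj'
      rw [hd.edgeKey_eq_iff hj' hj, hd'.edgeKey_eq_iff hj' hj, ih _ (hsrc j hj).2,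
        ih _ (hsrc j' hj').2, (hsrc j hj).1, (hsrc j' hj').1,
        hd.letter j' j _ _ (List.getElem?_eq_getElem hj') (List.getElem?_eq_getElem hj),
        hd'.letter j' j _ _ (List.getElem?_eq_getElem hj') (List.getElem?_eq_getElem hj)]
    intro a
    simp only [labels]
    induction a with
    | zero => intro _; rfl
    | succ a iha =>
      intro ha
      have hfirst : firstKey Z g sg (labels L.length m W Z g sg ω i) a =
          firstKey Z' g' sg' (labels L.length m W Z' g' sg' ω i) a := by
        apply le_antisymm
        · exact Nat.find_min' _ ((hkey a ha _ ((firstKey_le a).trans_lt ha)).2 (edgeKey_firstKey a))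
        · exact Nat.find_min' _ ((hkey a ha _ ((firstKey_le a).trans_lt ha)).1 (edgeKey_firstKey a))
      rw [newLabel, newLabel, iha (by omega), hsg a ha, hfirst]

/-- The labels never separate prefixes that agree in `F / F⁽ⁱ⁾`. -/
theorem Describes.labels_eq (hd : Describes L Z g sg) (hW : L.length * 2 ^ m ≤ W) (ω : ℕ → Bool)
    (i : ℕ) : ∀ a ≤ L.length, ∀ b ≤ L.length,
      ((FreeGroup.mk (L.take a) : FreeGroup α) : FreeGroup α ⧸ derivedSeries (FreeGroup α) i) =
        FreeGroup.mk (L.take b) →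
      labels L.length m W Z g sg ω i a = labels L.length m W Z g sg ω i b := by
  induction i with
  | zero => intros; rfl
  | succ i ih =>
    intro a ha b hb h
    have hn : (derivedSeries (FreeGroup α) i).Normal := derivedSeries_normal _ i
    exact hd.newLabel_eq (N := derivedSeries (FreeGroup α) i) (Q := 2 ^ m)
      (fun j => bitsVal_lt _ _) (hW.trans (by nlinarith)) ih ha hb h

/-- Without collisions, the labels separate the prefixes that differ in `F / F⁽ⁱ⁾`. -/
theorem Describes.eq_of_labels_eq (hd : Describes L Z g sg) (hW : L.length * 2 ^ m ≤ W)
    {ω : ℕ → Bool} {l : ℕ}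
    (hω : ∀ i < l, ∀ a ≤ L.length, ∀ b ≤ L.length,
      flow (derivedSeries (FreeGroup α) i) 1 (L.take a) ≠
        flow (derivedSeries (FreeGroup α) i) 1 (L.take b) →
      ω ∉ collision (derivedSeries (FreeGroup α) i) L m i a b)
    (i : ℕ) (hi : i ≤ l) : ∀ a ≤ L.length, ∀ b ≤ L.length,
      labels L.length m W Z g sg ω i a = labels L.length m W Z g sg ω i b →
      ((FreeGroup.mk (L.take a) : FreeGroup α) : FreeGroup α ⧸ derivedSeries (FreeGroup α) i) =
        FreeGroup.mk (L.take b) := by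
  induction i with
  | zero => intros; rw [QuotientGroup.eq]; exact Subgroup.mem_top _
  | succ i ih =>
    intro a ha b hb h
    have hn : (derivedSeries (FreeGroup α) i).Normal := derivedSeries_normal _ i
    have hB : L.length * 2 ^ m ≤ 2 * W * (i + 1) := hW.trans (by nlinarith)
    have hlab := fun a ha b hb =>
      (⟨ih (by omega) a ha b hb, hd.labels_eq hW ω i a ha b hb⟩ : _ ↔ _)
    have e1 := hd.newLabel_eq_linearCombination (N := derivedSeries (FreeGroup α) i)
      (ρ := fun j => blockVal m ω (i * L.length + j)) (fun j => bitsVal_lt _ _) hB hlab ha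
    have e2 := hd.newLabel_eq_linearCombination (N := derivedSeries (FreeGroup α) i)
      (ρ := fun j => blockVal m ω (i * L.length + j)) (fun j => bitsVal_lt _ _) hB hlab hb
    rw [labels] at h
    rw [h] at e1
    refine (flow_eq_iff (N := derivedSeries (FreeGroup α) i) _ _).1 ?_
    by_contra hne
    refine hω i (by omega) a ha b hb hne ?_
    rw [collision, Set.mem_ofPred_eq, map_sub, sub_eq_zero]
    exact add_left_cancel (e1.symm.trans e2)

/-- If the word `L` is nontrivial modulo `F⁽ˡ⁾`, then the first and the last label after `l` rounds
differ with high probability, by the union bound over the rounds and the pairs of prefixes. -/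
theorem Describes.le_coinMeasure (hd : Describes L Z g sg) (hW : L.length * 2 ^ m ≤ W) (l : ℕ)
    (hne : FreeGroup.mk L ∉ derivedSeries (FreeGroup α) l) :
    1 - l * (L.length + 1 : ℝ) ^ 2 * ((2 : ℝ) ^ m)⁻¹ ≤ coinMeasure.real
      {ω | labels L.length m W Z g sg ω l L.length ≠ labels L.length m W Z g sg ω l 0} := by
  classical
  let D := derivedSeries (FreeGroup α)
  let I : Finset (ℕ × ℕ × ℕ) := (Finset.range l ×ˢ Finset.range (L.length + 1) ×ˢ
    Finset.range (L.length + 1)).filter fun p =>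
      flow (D p.1) 1 (L.take p.2.1) ≠ flow (D p.1) 1 (L.take p.2.2)
  let Bad : Set (ℕ → Bool) := ⋃ p ∈ I, collision (D p.1) L m p.1 p.2.1 p.2.2
  have hbad : coinMeasure.real Bad ≤ l * (L.length + 1 : ℝ) ^ 2 * ((2 : ℝ) ^ m)⁻¹ := by
    refine (measureReal_biUnion_finset_le I _).trans ?_
    refine (Finset.sum_le_card_nsmul I _ ((2 : ℝ) ^ m)⁻¹ fun p hp => ?_).trans ?_
    · simp only [I, Finset.mem_filter, Finset.mem_product, Finset.mem_range] at hp
      exact coinMeasure_collision_le m p.1 (by omega) (by omega) hp.2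
    · rw [nsmul_eq_mul]
      gcongr
      have : I.card ≤ l * ((L.length + 1) * (L.length + 1)) :=
        (Finset.card_filter_le _ _).trans (by simp)
      calc (I.card : ℝ) ≤ (l * ((L.length + 1) * (L.length + 1)) : ℕ) := by exact_mod_cast this
        _ = _ := by push_cast; ring
  have hsub : Badᶜ ⊆
      {ω | labels L.length m W Z g sg ω l L.length ≠ labels L.length m W Z g sg ω l 0} := by
    intro ω hω heq
    refine hne ?_
    have := hd.eq_of_labels_eq hW (ω := ω) (l := l) (fun i hi a ha b hb hf hc => hω ?_) l le_rfl
      L.length le_rfl 0 (Nat.zero_le _) heq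
    · rw [List.take_length, List.take_zero, ← one_eq_mk, QuotientGroup.eq, mul_one] at this
      exact (Subgroup.inv_mem_iff _).1 this
    · refine Set.mem_biUnion (x := (i, a, b)) ?_ hc
      simp only [I, Finset.mem_coe, Finset.mem_filter, Finset.mem_product, Finset.mem_range]
      exact ⟨⟨hi, by omega, by omega⟩, hf⟩
  have h1 : 1 ≤ coinMeasure.real Bad + coinMeasure.real Badᶜ := by
    have := measureReal_union_le (μ := coinMeasure) Bad Badᶜ
    rwa [Set.union_compl_self, probReal_univ] at this
  have h2 := measureReal_mono (μ := coinMeasure) hsub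
  linarith

end

end RAM

/-! ### Reading the input: numbering the generators by a trie -/

namespace RAM

attribute [local simp] evalAll okAll Op.eval Op.ok St.set St.setArr Function.update_apply

theorem Wp.seq_le {M t t' u : ℕ} {c₁ c₂ : Cmd} {s : St} {Q : St → Prop} (hu : t + t' ≤ u)
    (h : Wp M c₁ s t (fun s' => Wp M c₂ s' t' Q)) : Wp M (.seq c₁ c₂) s u Q :=
  (Wp.seq h).mono hu fun _ h => h

theorem Wp.ite_le {M t u : ℕ} {c₁ c₂ : Cmd} {s : St} {x : Var} {Q : St → Prop} (hu : t + 2 ≤ u)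
    (h₁ : s.v x ≠ 0 → Wp M c₁ s t Q) (h₂ : s.v x = 0 → Wp M c₂ s t Q) :
    Wp M (.ite x c₁ c₂) s u Q :=
  (Wp.ite h₁ h₂).mono hu fun _ h => h

/-- The node reached from the node `c` by the word `l` in a trie with child table `T`: entry
`2 * c + b` of `T` is the child of `c` for the bit `b`, or `0` if there is none. -/
def trieWalk (T : ℕ → ℕ) : ℕ → List Bool → ℕ
  | c, [] => c
  | c, b :: l => trieWalk T (T (2 * c + b.toNat)) l

/-- The trie contains the path from the node `c` that is labelled by `l`. -/
def TriePath (T : ℕ → ℕ) : ℕ → List Bool → Prop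
  | _, [] => True
  | c, b :: l => T (2 * c + b.toNat) ≠ 0 ∧ TriePath T (T (2 * c + b.toNat)) l

/-- Nodes are numbered by `0` (the root), …, `K`, and no node is the child of two parents. -/
structure TrieInv (T : ℕ → ℕ) (K : ℕ) : Prop where
  le : ∀ i, T i ≤ K
  inj : ∀ i j, T i = T j → T i ≠ 0 → i = j

/-- The trie `T'` extends `T`. -/
def TrieLe (T T' : ℕ → ℕ) : Prop := ∀ i, T i ≠ 0 → T' i = T i

theorem TrieLe.trans {T T' T'' : ℕ → ℕ} (h : TrieLe T T') (h' : TrieLe T' T'') : TrieLe T T'' :=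
  fun i hi => by rw [h' i (by rwa [h i hi]), h i hi]

theorem TriePath.extend {T T' : ℕ → ℕ} (h : TrieLe T T') : ∀ {l : List Bool} {c : ℕ},
    TriePath T c l → TriePath T' c l ∧ trieWalk T' c l = trieWalk T c l
  | [], _, _ => ⟨trivial, rfl⟩
  | b :: l, c, hl => by
    have e := h _ hl.1
    have ih := TriePath.extend h hl.2
    refine ⟨⟨by rw [e]; exact hl.1, by rw [e]; exact ih.1⟩, ?_⟩
    rw [trieWalk, e, ih.2]; rfl

/-- Words of equal length that lead to the same node are equal. -/
theorem TrieInv.walk_inj {T : ℕ → ℕ} {K : ℕ} (hT : TrieInv T K) : ∀ {l l' : List Bool} {c c' : ℕ},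
    l.length = l'.length → TriePath T c l → TriePath T c' l' →
    trieWalk T c l = trieWalk T c' l' → c = c' ∧ l = l'
  | [], [], _, _, _, _, _, h => ⟨h, rfl⟩
  | [], _ :: _, _, _, hlen, _, _, _ => by simp at hlen
  | _ :: _, [], _, _, hlen, _, _, _ => by simp at hlen
  | b :: l, b' :: l', c, c', hlen, h1, h2, h => by
    obtain ⟨h3, rfl⟩ := hT.walk_inj (by simpa using hlen) h1.2 h2.2 h
    have h4 := hT.inj _ _ h3 h1.1
    have hb := Bool.toNat_lt b
    have hb' := Bool.toNat_lt b'
    have h5 : b.toNat = b'.toNat := by omega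
    refine ⟨by omega, ?_⟩
    cases b <;> cases b' <;> simp_all

/-- Reads one bit and moves to the corresponding child of the current node, which is created if
necessary. -/
def bitStep : Cmd :=
  .seq (.block [.read .bit, .add .idx .cur .cur, .add .idx .idx .bit, .get .nxt .trie .idx])
    (.seq (.ite .nxt (.block [])
        (.block [.add .nodes .nodes .one, .put .trie .idx .nodes, .copy .nxt .nodes]))
      (.block [.copy .cur .nxt]))

/-- Reads `k` bits. -/
def bitSteps : ℕ → Cmd
  | 0 => .block []
  | k + 1 => .seq bitStep (bitSteps k)

/-- The parts of the state that are not touched while the bits of a letter are read. -/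
structure BitFrame (s s' : St) : Prop where
  len : s'.v .len = s.v .len
  one : s'.v .one = s.v .one
  two : s'.v .two = s.v .two
  coins : s'.coins = s.coins
  arr : ∀ A, A ≠ Arr.trie → s'.a A = s.a A

theorem BitFrame.trans {s s' s'' : St} (h : BitFrame s s') (h' : BitFrame s' s'') :
    BitFrame s s'' :=
  ⟨h'.len.trans h.len, h'.one.trans h.one, h'.two.trans h.two, h'.coins.trans h.coins,
    fun A hA => (h'.arr A hA).trans (h.arr A hA)⟩

theorem bitStep_spec {M : ℕ} {s : St} {b : Bool} {rest : List Bool} (hone : s.v .one = 1)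
    (hin : s.input = b :: rest) (hT : TrieInv (s.a .trie) (s.v .nodes))
    (hcur : s.v .cur ≤ s.v .nodes) (hM : 2 * s.v .nodes + 1 ≤ M) :
    Wp M bitStep s 10 fun s' => BitFrame s s' ∧ s'.input = rest ∧
      TrieInv (s'.a .trie) (s'.v .nodes) ∧ TrieLe (s.a .trie) (s'.a .trie) ∧
      s'.v .nodes ≤ s.v .nodes + 1 ∧ s'.v .cur ≤ s'.v .nodes ∧
      s'.a .trie (2 * s.v .cur + b.toNat) ≠ 0 ∧
      s'.v .cur = s'.a .trie (2 * s.v .cur + b.toNat) := by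
  have hb := Bool.toNat_lt b
  refine Wp.seq_le (t := 4) (t' := 6) le_rfl (Wp.block (by simp) ?_ ?_)
  · simp [hin]; omega
  refine Wp.seq_le (t := 5) (t' := 1) le_rfl (Wp.ite_le (t := 3) le_rfl ?_ ?_)
  · intro hx
    refine Wp.block (by simp) (by simp) (Wp.block (by simp) (by simp) ?_)
    simp [hin, ← two_mul] at hx ⊢
    exact ⟨⟨rfl, rfl, rfl, rfl, fun _ _ => rfl⟩, hT, fun _ _ => rfl, hT.le _, hx⟩
  · intro hx
    simp [hin, ← two_mul] at hx
    refine Wp.block (by simp) (by simp [hin, hone]; omega)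
      (Wp.block (by simp) (by simp) ?_)
    simp [hin, hone, ← two_mul]
    refine ⟨⟨rfl, by simp, rfl, rfl, fun A hA => by simp [hA]⟩, ⟨fun i => ?_, fun i j => ?_⟩,
      fun i hi => ?_⟩
    · rw [Function.update_apply]
      split_ifs
      · exact le_rfl
      · exact (hT.le i).trans (Nat.le_succ _)
    · have hi := hT.le i
      have hj := hT.le j
      simp only [Function.update_apply]
      split_ifs with h1 h2 h2
      · intros; rw [h1, h2]
      · intros; omega
      · intros; omega
      · exact hT.inj i j
    · rw [Function.update_apply, if_neg]
      rintro rfl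
      exact hi hx

theorem bitSteps_spec {M : ℕ} {rest : List Bool} : ∀ (bits : List Bool) {s : St},
    s.v .one = 1 → s.input = bits ++ rest → TrieInv (s.a .trie) (s.v .nodes) →
    s.v .cur ≤ s.v .nodes → 2 * (s.v .nodes + bits.length) + 1 ≤ M →
    Wp M (bitSteps bits.length) s (10 * bits.length) fun s' => BitFrame s s' ∧ s'.input = rest ∧
      TrieInv (s'.a .trie) (s'.v .nodes) ∧ TrieLe (s.a .trie) (s'.a .trie) ∧
      s'.v .nodes ≤ s.v .nodes + bits.length ∧
      TriePath (s'.a .trie) (s.v .cur) bits ∧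
      s'.v .cur = trieWalk (s'.a .trie) (s.v .cur) bits
  | [], s, _, hin, hT, _, _ => Wp.block (by simp) trivial
      ⟨⟨rfl, rfl, rfl, rfl, fun _ _ => rfl⟩, hin, hT, fun _ _ => rfl, le_rfl, trivial, rfl⟩
  | b :: bits, s, hone, hin, hT, hcur, hM => by
    rw [List.length_cons] at hM ⊢
    refine Wp.seq_le (t := 10) (t' := 10 * bits.length) (by omega) ((bitStep_spec hone hin hT hcur
      (by omega)).mono le_rfl ?_)
    rintro s' ⟨hf, hin', hT', hle, hnodes, hcur', hne, heq⟩
    refine (bitSteps_spec bits (by rw [hf.one, hone]) hin' hT' hcur' (by omega)).mono le_rfl ?_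
    rintro s'' ⟨hf', hin'', hT'', hle', hnodes', hpath, heq'⟩
    have e := hle' _ hne
    refine ⟨hf.trans hf', hin'', hT'', hle.trans hle', by omega, ⟨by rwa [e], ?_⟩, ?_⟩
    · rw [e, ← heq]; exact hpath
    · rw [heq', trieWalk, e, ← heq]

/-- Reads the remaining `k` bits of a letter, records the letter, and reads the next sign bit. -/
def readLetter (k : ℕ) : Cmd :=
  .seq (.block [.put .sign .len .bit, .const .cur 0])
    (.seq (bitSteps k)
      (.block [.put .letter .len .cur, .add .len .len .one, .read .bit, .sub .flag .two .bit]))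

/-- Reads the whole input; `k` is the number of bits that encode a generator. -/
def readWord (k : ℕ) : Cmd :=
  .seq (.block [.const .one 1, .const .two 2, .read .bit, .sub .flag .two .bit])
    (.loop .flag (readLetter k))

/-- The code of the generator of a letter. -/
def indexBits {r : ℕ} (a : Fin r × Bool) : List Bool :=
  List.ofFn (fun j : Fin (Nat.clog 2 r) => Nat.testBit a.1.val j.val)

theorem indexBits_inj {r : ℕ} {a a' : Fin r × Bool} (h : indexBits a = indexBits a') :
    a.1 = a'.1 := by
  have h1 := List.ofFn_injective h
  have hr : r ≤ 2 ^ Nat.clog 2 r := Nat.le_pow_clog (by norm_num) r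
  refine Fin.ext (Nat.eq_of_testBit_eq fun j => ?_)
  by_cases hj : j < Nat.clog 2 r
  · exact congrFun h1 ⟨j, hj⟩
  · have h2 : 2 ^ Nat.clog 2 r ≤ 2 ^ j := Nat.pow_le_pow_right (by norm_num) (by omega)
    rw [Nat.testBit_lt_two_pow (by omega), Nat.testBit_lt_two_pow (by omega)]

/-- The first bit of `x`, or the end marker, has been read. -/
def Fetched (x : List Bool) (s : St) : Prop :=
  match x with
  | [] => s.v .bit = 2 ∧ s.v .flag = 0 ∧ s.input = []
  | b :: l => s.v .bit = b.toNat ∧ s.v .flag ≠ 0 ∧ s.input = l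

/-- The effect of reading the next bit. -/
theorem fetch_spec {s : St} (h2 : s.v .two = 2) {s' : St}
    (hs' : s' = evalAll [.read .bit, .sub .flag .two .bit] s) :
    Fetched s.input s' ∧ s'.a = s.a ∧ s'.coins = s.coins ∧
      ∀ x, x ≠ Var.bit → x ≠ Var.flag → s'.v x = s.v x := by
  subst hs'
  cases hx : s.input with
  | nil => simp +contextual [Fetched, hx, h2]
  | cons b l =>
    have := Bool.toNat_lt b
    simp +contextual [Fetched, hx, h2]; omega

/-- The state after `k` letters of the word `L` have been read. -/
structure ReadInv {r : ℕ} (L : List (Fin r × Bool)) (ω : ℕ → Bool) (k : ℕ) (s : St) : Prop where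
  len : s.v .len = k
  one : s.v .one = 1
  two : s.v .two = 2
  coins : s.coins = ω
  label : ∀ i, s.a .label i = 0
  table : ∀ i, s.a .table i = 0
  trie : TrieInv (s.a .trie) (s.v .nodes)
  nodes : s.v .nodes ≤ k * Nat.clog 2 r
  letter : ∀ j < k, ∀ a, L[j]? = some a → TriePath (s.a .trie) 0 (indexBits a) ∧
    s.a .letter j = trieWalk (s.a .trie) 0 (indexBits a)
  sign : ∀ j < k, ∀ a, L[j]? = some a → s.a .sign j = a.2.toNat
  fetched : Fetched ((L.drop k).flatMap letterCode) s

theorem readWord_spec {r : ℕ} (L : List (Fin r × Bool)) (ω : ℕ → Bool) {M : ℕ}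
    (hM : 2 * (L.length * (Nat.clog 2 r + 1)) + 2 ≤ M) :
    Wp M (readWord (Nat.clog 2 r)) (St.start (L.flatMap letterCode) ω)
      (4 + (L.length * (6 + 10 * Nat.clog 2 r + 2) + 1)) (ReadInv L ω L.length) := by
  refine Wp.seq (Wp.block (by simp) (by simp; omega) ?_)
  refine Wp.loop (t := 6 + 10 * Nat.clog 2 r) L.length (ReadInv L ω) ?_ ?_ ?_
  · intro k hk s hs
    have hLk := List.getElem?_eq_getElem hk
    set a := L[k] with ha
    have hdrop : L.drop k = a :: L.drop (k + 1) := List.drop_eq_getElem_cons hk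
    have hf := hs.fetched
    rw [hdrop, List.flatMap_cons] at hf
    obtain ⟨hbit, hflag, hin⟩ : s.v .bit = a.2.toNat ∧ s.v .flag ≠ 0 ∧
      s.input = indexBits a ++ (L.drop (k + 1)).flatMap letterCode := hf
    refine ⟨hflag, Wp.seq_le (t := 2) (t' := 10 * Nat.clog 2 r + 4) (by omega)
      (Wp.block (by simp) (by simp) ?_)⟩
    have hlen : (indexBits a).length = Nat.clog 2 r := by simp [indexBits]
    have hk1 : (k + 1) * (Nat.clog 2 r + 1) ≤ L.length * (Nat.clog 2 r + 1) :=
      Nat.mul_le_mul_right _ hk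
    have hk2 : (k + 1) * (Nat.clog 2 r + 1) = k * Nat.clog 2 r + Nat.clog 2 r + k + 1 := by ring
    have hn := hs.nodes
    have spec := bitSteps_spec (M := M) (rest := (L.drop (k + 1)).flatMap letterCode) (indexBits a)
      (s := evalAll [.put .sign .len .bit, .const .cur 0] s) (by simpa using hs.one)
      (by simpa using hin) (by simpa using hs.trie) (by simp) (by simp [hlen]; omega)
    rw [hlen] at spec
    refine Wp.seq (spec.mono le_rfl ?_)
    rintro s' ⟨hf', hin', hT', hle, hnodes, hpath, hcur⟩
    simp at hle hnodes hpath hcur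
    have f1 := hf'.len
    have f2 := hf'.one
    have f3 := hf'.two
    have f4 := hf'.coins
    have f5 := hf'.arr .letter (by simp)
    have f6 := hf'.arr .sign (by simp)
    have f7 := hf'.arr .label (by simp)
    have f8 := hf'.arr .table (by simp)
    simp [hs.len, hs.one, hs.two, hs.coins] at f1 f2 f3 f4 f5 f6 f7 f8
    refine Wp.block (by simp) ?_ ?_
    · simp [f1, f2]
      nlinarith
    · obtain ⟨hfe, h1, h2, h3⟩ := fetch_spec
        (s := evalAll [.put .letter .len .cur, .add .len .len .one] s') (by simpa using f3) rfl
      change ReadInv L ω (k + 1) (evalAll [.read .bit, .sub .flag .two .bit]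
        (evalAll [.put .letter .len .cur, .add .len .len .one] s'))
      rw [show (evalAll [.put .letter .len .cur, .add .len .len .one] s').input =
        (L.drop (k + 1)).flatMap letterCode by simpa using hin'] at hfe
      refine ⟨?_, ?_, ?_, ?_, ?_, ?_, ?_, ?_, ?_, ?_, hfe⟩
      · rw [h3 _ (by simp) (by simp)]; simp [f1, f2]
      · rw [h3 _ (by simp) (by simp)]; simp [f2]
      · rw [h3 _ (by simp) (by simp)]; simp [f3]
      · rw [h2]; simp [f4]
      · rw [h1]; simp [f7, hs.label]
      · rw [h1]; simp [f8, hs.table]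
      · rw [h1, h3 _ (by simp) (by simp)]; simpa using hT'
      · rw [h3 _ (by simp) (by simp)]; simp; nlinarith
      · rw [h1]
        intro j hj a' ha'
        simp [f1, f5]
        by_cases hjk : j = k
        · subst hjk
          obtain rfl : a' = a := Option.some.inj (ha'.symm.trans hLk)
          simp [hcur, hpath]
        · obtain ⟨h4, h5⟩ := hs.letter j (by omega) a' ha'
          obtain ⟨h6, h7⟩ := h4.extend hle
          simp [hjk, h6, h7, h5]
      · rw [h1]
        intro j hj a' ha'
        simp [f6]
        by_cases hjk : j = k
        · subst hjk
          obtain rfl : a' = a := Option.some.inj (ha'.symm.trans hLk)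
          simp [hbit]
        · simp [hjk, hs.sign j (by omega) a' ha']
  · intro s hs
    have := hs.fetched
    rw [List.drop_length] at this
    exact this.2.1
  · obtain ⟨hfe, h1, h2, h3⟩ := fetch_spec
      (s := evalAll [.const .one 1, .const .two 2] (St.start (L.flatMap letterCode) ω))
      (by simp) rfl
    change ReadInv L ω 0 (evalAll [.read .bit, .sub .flag .two .bit]
        (evalAll [.const .one 1, .const .two 2] (St.start (L.flatMap letterCode) ω)))
    refine ⟨?_, ?_, ?_, ?_, ?_, ?_, ?_, ?_, fun j hj => absurd hj (Nat.not_lt_zero j),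
      fun j hj => absurd hj (Nat.not_lt_zero j), hfe⟩
    · rw [h3 _ (by simp) (by simp)]; simp [St.start]
    · rw [h3 _ (by simp) (by simp)]; simp
    · rw [h3 _ (by simp) (by simp)]; simp
    · rw [h2]; simp [St.start]
    · rw [h1]; simp [St.start]
    · rw [h1]; simp [St.start]
    · rw [h1, h3 _ (by simp) (by simp)]
      exact ⟨fun i => le_rfl, fun i j _ h => absurd rfl h⟩
    · rw [h3 _ (by simp) (by simp)]; simp [St.start]

/-- After the input has been read, the arrays describe the letters of the word. -/
theorem ReadInv.describes {r : ℕ} {L : List (Fin r × Bool)} {ω : ℕ → Bool} {s : St}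
    (hs : ReadInv L ω L.length s) : Describes L (s.v .nodes + 1) (s.a .letter)
      (fun j => decide (s.a .sign j ≠ 0)) := by
  have hwalk : ∀ (T : ℕ → ℕ) (K : ℕ), TrieInv T K → ∀ (l : List Bool) (c : ℕ), c ≤ K →
      trieWalk T c l ≤ K := by
    intro T K hT l
    induction l with
    | nil => intro c hc; exact hc
    | cons b l ih => intro c _; exact ih _ (hT.le _)
  refine ⟨fun j a ha => ?_, fun j hj => ?_, fun j j' a a' ha ha' => ?_⟩
  · simp only [hs.sign j (List.getElem?_eq_some_iff.1 ha).1 a ha]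
    cases a.2 <;> simp
  · rw [(hs.letter j hj _ (List.getElem?_eq_getElem hj)).2]
    exact Nat.lt_succ_of_le (hwalk _ _ hs.trie _ _ (Nat.zero_le _))
  · obtain ⟨h1, h2⟩ := hs.letter j (List.getElem?_eq_some_iff.1 ha).1 a ha
    obtain ⟨h1', h2'⟩ := hs.letter j' (List.getElem?_eq_some_iff.1 ha').1 a' ha'
    rw [h2, h2']
    constructor
    · intro h
      exact indexBits_inj (hs.trie.walk_inj (by simp [indexBits]) h1 h1' h).2
    · intro h
      simp [indexBits, h]

end RAM

/-! ### The rounds of the word-problem program -/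

namespace RAM

attribute [local simp] evalAll okAll Op.eval Op.ok St.set St.setArr Function.update_apply

/-- Puts a random number with `flips` bits into `rho`, which has to be zero before. -/
def flipCoins : Cmd :=
  .loop .flips (.block [.flip .bit, .add .rho .rho .rho, .add .rho .rho .bit,
    .sub .flips .flips .one])

theorem flipCoins_spec {M m : ℕ} {s : St} (hone : s.v .one = 1) (hflips : s.v .flips = m)
    (hrho : s.v .rho = 0) (hM : 2 ^ m ≤ M) :
    Wp M flipCoins s (m * 6 + 1) fun s' => s'.v .rho = bitsVal s.coins m ∧
      s'.coins = (fun t => s.coins (m + t)) ∧ s'.a = s.a ∧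
      ∀ x, x ≠ Var.bit → x ≠ Var.rho → x ≠ Var.flips → s'.v x = s.v x := by
  refine (Wp.loop (t := 4) m (fun k s' => s'.v .flips = m - k ∧ s'.v .rho = bitsVal s.coins k ∧
      s'.coins = (fun t => s.coins (k + t)) ∧ s'.a = s.a ∧
      ∀ x, x ≠ Var.bit → x ≠ Var.rho → x ≠ Var.flips → s'.v x = s.v x) ?_ ?_ ?_).mono le_rfl
    fun _ h => h.2
  · rintro k hk s' ⟨h1, h2, h3, h4, h5⟩
    have hone' := (h5 .one (by simp) (by simp) (by simp)).trans hone
    have hb := Bool.toNat_lt (s.coins k)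
    have hlt := bitsVal_lt s.coins (k + 1)
    have hpow : 2 ^ (k + 1) ≤ 2 ^ m := Nat.pow_le_pow_right (by norm_num) hk
    rw [bitsVal] at hlt
    refine ⟨by omega, Wp.block (by simp) ?_ ?_⟩
    · simp [h2, h3]; omega
    · simp +contextual [h1, h2, h3, h4, h5, bitsVal]
      refine ⟨by omega, by omega, ?_⟩
      funext t
      congr 1
      omega
  · rintro s' ⟨h1, -⟩
    omega
  · exact ⟨hflips, hrho, by simp, rfl, fun _ _ _ _ => rfl⟩

/-- `src` becomes the label of the initial vertex of the current edge. -/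
def selectSrc : Cmd := .ite .sign (.block [.copy .src .old]) (.block [.copy .src .new])

theorem selectSrc_spec {M : ℕ} {s : St} : Wp M selectSrc s 3 fun s' =>
    s' = s.set .src (if s.v .sign ≠ 0 then s.v .old else s.v .new) :=
  Wp.ite (t := 1) (fun h => Wp.block (by simp) (by simp) (by simp [h]))
    (fun h => Wp.block (by simp) (by simp) (by simp [h]))

/-- If the current edge has no weight yet, then it gets the weight `rho`. -/
def lookupWeight : Cmd :=
  .ite .val (.block []) (.block [.copy .val .rho, .put .table .idx .val])

theorem lookupWeight_spec {M : ℕ} {s : St} : Wp M lookupWeight s 4 fun s' =>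
    s' = if s.v .val ≠ 0 then s
      else (s.set .val (s.v .rho)).setArr .table (s.v .idx) (s.v .rho) :=
  Wp.ite (t := 2) (fun h => Wp.block (by simp) (by simp) (by simp [h]))
    (fun h => Wp.block (by simp) (by simp) (by simp [h]))

/-- Adds or subtracts the weight of the current edge. -/
def updateHash : Cmd := .ite .sign (.block [.add .hash .hash .val]) (.block [.sub .hash .hash .val])

theorem updateHash_spec {M : ℕ} {s : St} (h : s.v .sign ≠ 0 → s.v .hash + s.v .val ≤ M) :
    Wp M updateHash s 3 fun s' =>
      s' = s.set .hash (if s.v .sign ≠ 0 then s.v .hash + s.v .val else s.v .hash - s.v .val) :=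
  Wp.ite (t := 1) (fun h' => Wp.block (by simp) (by simpa using h h') (by simp [h']))
    (fun h' => Wp.block (by simp) (by simp) (by simp [h']))

/-- Computes the new label of the next prefix. -/
def labelStep : Cmd :=
  .seq (.block [.add .succ .pos .one, .get .new .label .succ, .get .letter .letter .pos,
    .get .sign .sign .pos, .copy .flips .coinCount, .const .rho 0]) <|
  .seq flipCoins <|
  .seq (.block [.add .rho .rho .one]) <|
  .seq selectSrc <|
  .seq (.block [.mul .idx .src .stride, .add .idx .idx .letter, .get .val .table .idx]) <|
  .seq lookupWeight <|
  .seq updateHash <|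
  .block [.put .label .succ .hash, .copy .old .new, .copy .pos .succ, .sub .todo .todo .one]

/-- One round: all labels are replaced by new ones. -/
def round : Cmd :=
  .seq (.block [.add .base .base .shift, .copy .hash .base, .const .pos 0, .get .old .label .pos,
    .put .label .pos .base, .copy .todo .len])
  (.seq (.loop .todo labelStep) (.block [.sub .levels .levels .one]))

section

variable {n m W Z : ℕ} {g : ℕ → ℕ} {sg : ℕ → Bool} {ω : ℕ → Bool} {M l i : ℕ}

theorem labels_bounds {a : ℕ} (ha : a ≤ n) (i : ℕ) :
    2 * W * i ≤ labels n m W Z g sg ω i a + n * 2 ^ m ∧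
      labels n m W Z g sg ω i a ≤ 2 * W * i + n * 2 ^ m := by
  cases i with
  | zero => simp [labels]
  | succ i =>
    have h := newLabel_bounds (Z := Z) (g := g) (sg := sg) (lab := labels n m W Z g sg ω i)
      (ρ := fun j => blockVal m ω (i * n + j)) (B := 2 * W * (i + 1)) (Q := 2 ^ m)
      (fun j => bitsVal_lt _ _) a
    have := Nat.mul_le_mul_right (2 ^ m) ha
    rw [labels]
    omega

/-- The quantities that are fixed during the rounds. -/
structure RoundEnv (n m W Z : ℕ) (g : ℕ → ℕ) (sg : ℕ → Bool) (s : St) : Prop where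
  one : s.v .one = 1
  len : s.v .len = n
  coinCount : s.v .coinCount = m
  shift : s.v .shift = 2 * W
  stride : s.v .stride = Z
  letter : s.a .letter = g
  sign : ∀ j, sg j = decide (s.a .sign j ≠ 0)

/-- The state after `i` rounds; `q` is the number of rounds that are left. All table entries with
indices that can occur in later rounds are unused. -/
structure RoundInv (n m W Z : ℕ) (g : ℕ → ℕ) (sg : ℕ → Bool) (ω : ℕ → Bool) (i q : ℕ) (s : St) :
    Prop extends RoundEnv n m W Z g sg s where
  base : s.v .base = 2 * W * i
  levels : s.v .levels = q
  label : ∀ j ≤ n, s.a .label j = labels n m W Z g sg ω i j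
  coins : s.coins = fun t => ω (i * n * m + t)
  table : ∀ idx, (2 * W * i - W) * Z ≤ idx → s.a .table idx = 0

/-- The state during round `i`, after `k` letters have been processed. -/
structure StepInv (n m W Z : ℕ) (g : ℕ → ℕ) (sg : ℕ → Bool) (ω : ℕ → Bool) (i q k : ℕ) (s : St) :
    Prop extends RoundEnv n m W Z g sg s where
  base : s.v .base = 2 * W * (i + 1)
  levels : s.v .levels = q
  pos : s.v .pos = k
  todo : s.v .todo = n - k
  hash : s.v .hash = labels n m W Z g sg ω (i + 1) k
  old : s.v .old = labels n m W Z g sg ω i k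
  label_le : ∀ j ≤ k, s.a .label j = labels n m W Z g sg ω (i + 1) j
  label_gt : ∀ j, k < j → j ≤ n → s.a .label j = labels n m W Z g sg ω i j
  coins : s.coins = fun t => ω ((i * n + k) * m + t)
  table_key : ∀ j < k, s.a .table (edgeKey Z g sg (labels n m W Z g sg ω i) j) =
    blockVal m ω (i * n + firstKey Z g sg (labels n m W Z g sg ω i) j) + 1
  table_free : ∀ idx, (2 * W * i - W) * Z ≤ idx →
    (∀ j < k, edgeKey Z g sg (labels n m W Z g sg ω i) j ≠ idx) → s.a .table idx = 0

/-- A table that holds the weights of the first `k` edges can be extended to edge `k`. -/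
theorem table_step {lab ρ T T' : ℕ → ℕ} {k w lower v : ℕ}
    (hkey : ∀ j < k, T (edgeKey Z g sg lab j) = ρ (firstKey Z g sg lab j) + 1)
    (hfree : ∀ idx, lower ≤ idx → (∀ j < k, edgeKey Z g sg lab j ≠ idx) → T idx = 0)
    (hlow : lower ≤ edgeKey Z g sg lab k) (hw : w = ρ k + 1)
    (hv : v = if T (edgeKey Z g sg lab k) ≠ 0 then T (edgeKey Z g sg lab k) else w)
    (hT' : T' = if T (edgeKey Z g sg lab k) ≠ 0 then T
      else Function.update T (edgeKey Z g sg lab k) w) :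
    v = ρ (firstKey Z g sg lab k) + 1 ∧
      (∀ j < k + 1, T' (edgeKey Z g sg lab j) = ρ (firstKey Z g sg lab j) + 1) ∧
      (∀ idx, lower ≤ idx → (∀ j < k + 1, edgeKey Z g sg lab j ≠ idx) → T' idx = 0) := by
  subst hw
  by_cases h0 : T (edgeKey Z g sg lab k) = 0
  · have hne : ∀ j < k, edgeKey Z g sg lab j ≠ edgeKey Z g sg lab k := fun j hj he => by
      have := hkey j hj
      rw [he, h0] at this
      omega
    have hfirst : firstKey Z g sg lab k = k := by
      refine le_antisymm (firstKey_le k) (not_lt.1 fun hlt => ?_)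
      exact hne _ hlt (edgeKey_firstKey k)
    rw [if_neg (not_not.2 h0)] at hv hT'
    subst hv hT'
    refine ⟨by rw [hfirst], fun j hj => ?_, fun idx hidx hj => ?_⟩
    · obtain hj | rfl := Nat.lt_succ_iff_lt_or_eq.1 hj
      · rw [Function.update_of_ne (hne j hj), hkey j hj]
      · rw [Function.update_self, hfirst]
    · rw [Function.update_of_ne (hj k (Nat.lt_succ_self k)).symm]
      exact hfree idx hidx fun j hjk => hj j (by omega)
  · rw [if_pos h0] at hv hT'
    subst hv hT'
    obtain ⟨j, hj, he⟩ : ∃ j < k, edgeKey Z g sg lab j = edgeKey Z g sg lab k := by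
      by_contra hne
      push Not at hne
      exact h0 (hfree _ hlow hne)
    have hk : T' (edgeKey Z g sg lab k) = ρ (firstKey Z g sg lab k) + 1 := by
      rw [← he, hkey j hj, firstKey_congr he]
    refine ⟨hk, fun j hj => ?_, fun idx hidx hj => hfree idx hidx fun j hjk => hj j (by omega)⟩
    obtain hj | rfl := Nat.lt_succ_iff_lt_or_eq.1 hj
    · exact hkey j hj
    · exact hk

theorem labelStep_spec {k q : ℕ} {s : St} (hk : k < n) (hi : i < l) (hg : ∀ j < n, g j < Z)
    (hW : (n + 1) * 2 ^ m ≤ W) (hM : 2 * W * (l + 1) * Z ≤ M)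
    (hs : StepInv n m W Z g sg ω i q k s) :
    Wp M labelStep s (6 * m + 25) (StepInv n m W Z g sg ω i q (k + 1)) := by
  have hpow : 1 ≤ 2 ^ m := Nat.one_le_two_pow
  have hWn : n * 2 ^ m + 2 ^ m ≤ W := by rwa [Nat.succ_mul] at hW
  have hnW : n + 1 ≤ W := (Nat.le_mul_of_pos_right _ (by omega)).trans hW
  have hgk := hg k hk
  have hM1 : 2 * W * (l + 1) ≤ M := (Nat.le_mul_of_pos_right _ (by omega)).trans hM
  have hWl : 2 * W * i + 2 * W + 2 * W ≤ 2 * W * (l + 1) := by nlinarith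
  set lab := labels n m W Z g sg ω i with hlab
  have hsrcn : srcPos sg k ≤ n := by rw [srcPos]; split_ifs <;> omega
  have hb := labels_bounds (m := m) (W := W) (Z := Z) (g := g) (sg := sg) (ω := ω) hsrcn i
  rw [← hlab] at hb
  have hb' := labels_bounds (m := m) (W := W) (Z := Z) (g := g) (sg := sg) (ω := ω)
    (show k + 1 ≤ n from hk) (i + 1)
  have hkey_lt : edgeKey Z g sg lab k < (lab (srcPos sg k) + 1) * Z := by
    rw [edgeKey, Nat.succ_mul]; omega
  have hkey_le : edgeKey Z g sg lab k ≤ M := hkey_lt.le.trans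
    ((Nat.mul_le_mul_right Z (by omega)).trans hM)
  have hkey_low : (2 * W * i - W) * Z ≤ edgeKey Z g sg lab k :=
    (Nat.mul_le_mul_right Z (by omega)).trans (Nat.le_add_right _ _)
  have hsgk := hs.sign k
  refine Wp.seq_le (t := 6) (t' := 6 * m + 19) (by omega) (Wp.block (by simp) ?_ ?_)
  · simp [hs.one, hs.pos]; omega
  refine Wp.seq_le (t := m * 6 + 1) (t' := 18) (by omega)
    ((flipCoins_spec (m := m) (by simp [hs.one]) (by simp [hs.coinCount]) (by simp)
      (by omega)).mono le_rfl ?_)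
  rintro s₁ ⟨hrho, hcoins, harr, hv⟩
  have v1 := hv .one (by simp) (by simp) (by simp)
  have v2 := hv .len (by simp) (by simp) (by simp)
  have v3 := hv .coinCount (by simp) (by simp) (by simp)
  have v4 := hv .shift (by simp) (by simp) (by simp)
  have v5 := hv .stride (by simp) (by simp) (by simp)
  have v6 := hv .base (by simp) (by simp) (by simp)
  have v7 := hv .levels (by simp) (by simp) (by simp)
  have v8 := hv .hash (by simp) (by simp) (by simp)
  have v9 := hv .succ (by simp) (by simp) (by simp)
  have v10 := hv .old (by simp) (by simp) (by simp)
  have v11 := hv .new (by simp) (by simp) (by simp)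
  have v12 := hv .letter (by simp) (by simp) (by simp)
  have v13 := hv .sign (by simp) (by simp) (by simp)
  have v14 := hv .todo (by simp) (by simp) (by simp)
  simp [hs.one, hs.len, hs.coinCount, hs.shift, hs.stride, hs.base, hs.levels, hs.hash, hs.pos,
    hs.old, hs.todo, hs.letter, hs.label_gt (k + 1) (by omega) hk, hs.coins]
    at hrho hcoins harr v1 v2 v3 v4 v5 v6 v7 v8 v9 v10 v11 v12 v13 v14
  have hsign : s₁.v .sign ≠ 0 ↔ sg k = true := by rw [v13, hsgk]; simp
  have hrho' : s₁.v .rho = blockVal m ω (i * n + k) := by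
    rw [hrho]; rfl
  have hlt : blockVal m ω (i * n + k) < 2 ^ m := bitsVal_lt _ _
  refine Wp.seq_le (t := 1) (t' := 17) (by omega) (Wp.block (by simp) ?_ ?_)
  · simp [hrho', v1]; omega
  refine Wp.seq_le (t := 3) (t' := 14) (by omega) (selectSrc_spec.mono le_rfl ?_)
  intro s₂ hs₂
  have hsrc : (if s₁.v .sign ≠ 0 then s₁.v .old else s₁.v .new) = lab (srcPos sg k) := by
    rw [srcPos]
    by_cases h : sg k = true
    · rw [if_pos (hsign.2 h), if_pos h, v10]
    · rw [if_neg (fun h' => h (hsign.1 h')), if_neg h, v11]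
  replace hs₂ : s₂ = (s₁.set .rho (blockVal m ω (i * n + k) + 1)).set .src (lab (srcPos sg k)) := by
    rw [hs₂, ← hsrc, ← hrho']
    simp [v1]
  obtain ⟨hwt, htk, htf⟩ := table_step (w := blockVal m ω (i * n + k) + 1)
    (ρ := fun j => blockVal m ω (i * n + j)) hs.table_key hs.table_free hkey_low rfl rfl rfl
  rw [← hlab] at hwt htk htf
  set T' : ℕ → ℕ := if s.a .table (edgeKey Z g sg lab k) ≠ 0 then s.a .table
      else Function.update (s.a .table) (edgeKey Z g sg lab k) (blockVal m ω (i * n + k) + 1)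
    with hT'
  set wt := if s.a .table (edgeKey Z g sg lab k) ≠ 0 then s.a .table (edgeKey Z g sg lab k)
    else blockVal m ω (i * n + k) + 1 with hwtdef
  have hkey : lab (srcPos sg k) * Z + g k = edgeKey Z g sg lab k := rfl
  refine Wp.seq_le (t := 3) (t' := 11) (by omega) (Wp.block (by simp) ?_ ?_)
  · simp [hs₂, v5, v12, hkey, hkey_le]; omega
  refine Wp.seq_le (t := 4) (t' := 7) (by omega) (lookupWeight_spec.mono le_rfl ?_)
  intro s₃ hs₃
  have hs₃' : s₃.v .val = wt ∧ s₃.a .table = T' ∧ (∀ A, A ≠ Arr.table → s₃.a A = s.a A) ∧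
      s₃.coins = s₁.coins ∧
      ∀ x, x ≠ Var.val → x ≠ Var.idx → x ≠ Var.rho → x ≠ Var.src → s₃.v x = s₁.v x := by
    rw [hs₃]
    by_cases h0 : s.a .table (edgeKey Z g sg lab k) = 0
    · simp +contextual [hs₂, v5, v12, hkey, harr, h0, hT', hwtdef]
    · simp +contextual [hs₂, v5, v12, hkey, harr, h0, hT', hwtdef]
  obtain ⟨w1, w2, w3, w4, w5⟩ := hs₃'
  clear hs₃ hs₂
  have hwt_le : wt ≤ 2 ^ m := by rw [hwt]; exact bitsVal_lt _ _
  have hh : s₃.v .hash = labels n m W Z g sg ω (i + 1) k := by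
    rw [w5 _ (by simp) (by simp) (by simp) (by simp), v8]
  have hsign₃ : s₃.v .sign ≠ 0 ↔ sg k = true := by
    rw [w5 _ (by simp) (by simp) (by simp) (by simp), hsign]
  have hstep : labels n m W Z g sg ω (i + 1) (k + 1) =
      if s₃.v .sign ≠ 0 then s₃.v .hash + s₃.v .val else s₃.v .hash - s₃.v .val := by
    rw [hh, w1, hwt]
    simp only [labels, newLabel, hsign₃]
    rfl
  refine Wp.seq_le (t := 3) (t' := 4) (by omega) ((updateHash_spec fun h => ?_).mono le_rfl ?_)
  · rw [if_pos h] at hstep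
    rw [← hstep]
    refine hb'.2.trans ?_
    have : 2 * W * (i + 1) = 2 * W * i + 2 * W := by ring
    omega
  intro s₄ hs₄
  rw [← hstep] at hs₄
  subst hs₄
  refine Wp.block (by simp) (by simp) ?_
  have u1 := w5 .one (by simp) (by simp) (by simp) (by simp)
  have u2 := w5 .len (by simp) (by simp) (by simp) (by simp)
  have u3 := w5 .coinCount (by simp) (by simp) (by simp) (by simp)
  have u4 := w5 .shift (by simp) (by simp) (by simp) (by simp)
  have u5 := w5 .stride (by simp) (by simp) (by simp) (by simp)
  have u6 := w5 .base (by simp) (by simp) (by simp) (by simp)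
  have u7 := w5 .levels (by simp) (by simp) (by simp) (by simp)
  have u9 := w5 .succ (by simp) (by simp) (by simp) (by simp)
  have u11 := w5 .new (by simp) (by simp) (by simp) (by simp)
  have u14 := w5 .todo (by simp) (by simp) (by simp) (by simp)
  rw [v1] at u1
  rw [v2] at u2
  rw [v3] at u3
  rw [v4] at u4
  rw [v5] at u5
  rw [v6] at u6
  rw [v7] at u7
  rw [v9] at u9
  rw [v11] at u11
  rw [v14] at u14
  refine ⟨⟨?_, ?_, ?_, ?_, ?_, ?_, ?_⟩, ?_, ?_, ?_, ?_, ?_, ?_, ?_, ?_, ?_, ?_, ?_⟩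
  · simp [u1]
  · simp [u2]
  · simp [u3]
  · simp [u4]
  · simp [u5]
  · simp [w3, hs.letter]
  · simpa [w3] using hs.sign
  · simp [u6]
  · simp [u7]
  · simp [u9]
  · simp [u14, u1]; omega
  · simp
  · simp [u11]
  · intro j hj
    simp [u9, w3]
    split_ifs with hjk
    · rw [hjk]
    · exact hs.label_le j (by omega)
  · intro j hj hjn
    simp [u9, w3]
    rw [if_neg (by omega)]
    exact hs.label_gt j (by omega) hjn
  · simp [w4, hcoins]
    funext t
    congr 1
    ring
  · simpa [w2] using htk
  · simpa [w2] using htf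

theorem round_spec {q : ℕ} {s : St} (hi : i < l) (hg : ∀ j < n, g j < Z) (hZ : 1 ≤ Z)
    (hW : (n + 1) * 2 ^ m ≤ W) (hM : 2 * W * (l + 1) * Z ≤ M)
    (hs : RoundInv n m W Z g sg ω i (q + 1) s) :
    Wp M round s (n * (6 * m + 27) + 8) (RoundInv n m W Z g sg ω (i + 1) q) := by
  have hM1 : 2 * W * (l + 1) ≤ M := (Nat.le_mul_of_pos_right _ (by omega)).trans hM
  have hWl : 2 * W * i + 2 * W + 2 * W ≤ 2 * W * (l + 1) := by nlinarith
  refine Wp.seq_le (t := 6) (t' := n * (6 * m + 27) + 2) (by omega) (Wp.block (by simp) ?_ ?_)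
  · simp [hs.base, hs.shift]; omega
  refine Wp.seq_le (t := n * (6 * m + 27) + 1) (t' := 1) (by omega)
    ((Wp.loop (t := 6 * m + 25) n (StepInv n m W Z g sg ω i (q + 1)) ?_ ?_ ?_).mono (by ring_nf; rfl)
      ?_)
  · intro k hk s' hs'
    refine ⟨?_, labelStep_spec hk hi hg hW hM hs'⟩
    rw [hs'.todo]; omega
  · intro s' hs'
    rw [hs'.todo, Nat.sub_self]
  · have hbase : 2 * W * i + 2 * W = 2 * W * (i + 1) := by ring
    refine ⟨⟨?_, ?_, ?_, ?_, ?_, ?_, ?_⟩, ?_, ?_, ?_, ?_, ?_, ?_, ?_, ?_, ?_, ?_, ?_⟩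
    · simp [hs.one]
    · simp [hs.len]
    · simp [hs.coinCount]
    · simp [hs.shift]
    · simp [hs.stride]
    · simp [hs.letter]
    · simpa using hs.sign
    · simp [hs.base, hs.shift, hbase]
    · simp [hs.levels]
    · simp
    · simp [hs.len]
    · simp [hs.base, hs.shift, hbase, labels, newLabel]
    · simp [hs.label]
    · intro j hj
      obtain rfl : j = 0 := by omega
      simp [hs.base, hs.shift, hbase, labels, newLabel]
    · intro j hj hjn
      simp [hj.ne', hs.label j hjn]
    · simp [hs.coins]
    · intro j hj; omega
    · intro idx hidx _
      simpa using hs.table idx hidx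
  · intro s' hs'
    refine Wp.block (by simp) (by simp) ⟨⟨?_, ?_, ?_, ?_, ?_, ?_, ?_⟩, ?_, ?_, ?_, ?_, ?_⟩
    · simp [hs'.one]
    · simp [hs'.len]
    · simp [hs'.coinCount]
    · simp [hs'.shift]
    · simp [hs'.stride]
    · simp [hs'.letter]
    · exact hs'.sign
    · simp [hs'.base]
    · simp [hs'.levels, hs'.one]
    · intro j hj
      simpa using hs'.label_le j hj
    · simp [hs'.coins, Nat.succ_mul]
    · intro idx hidx
      have e : 2 * W * (i + 1) - W = 2 * W * i + W := by
        have : 2 * W * (i + 1) = 2 * W * i + 2 * W := by ring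
        omega
      rw [e] at hidx
      refine hs'.table_free idx ((Nat.mul_le_mul_right Z (by omega)).trans hidx) fun j hj he => ?_
      have hsrcn : srcPos sg j ≤ n := by rw [srcPos]; split_ifs <;> omega
      have hb := (labels_bounds (m := m) (W := W) (Z := Z) (g := g) (sg := sg) (ω := ω) hsrcn i).2
      have hgj := hg j hj
      have h1 : edgeKey Z g sg (labels n m W Z g sg ω i) j <
          (labels n m W Z g sg ω i (srcPos sg j) + 1) * Z := by
        rw [edgeKey, Nat.succ_mul]; omega
      have hpow : 1 ≤ 2 ^ m := Nat.one_le_two_pow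
      rw [Nat.succ_mul] at hW
      have h2 : (labels n m W Z g sg ω i (srcPos sg j) + 1) * Z ≤ (2 * W * i + W) * Z :=
        Nat.mul_le_mul_right Z (by omega)
      omega

/-- At most `d` rounds, as long as `levels` is not zero. -/
def rounds : ℕ → Cmd
  | 0 => .block []
  | d + 1 => .ite .levels (.seq round (rounds d)) (.block [])

theorem rounds_spec (hg : ∀ j < n, g j < Z) (hZ : 1 ≤ Z) (hW : (n + 1) * 2 ^ m ≤ W) (d : ℕ) :
    ∀ {i q : ℕ} {s : St}, 2 * W * (i + q + 1) * Z ≤ M → RoundInv n m W Z g sg ω i q s →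
      Wp M (rounds d) s (min d q * (n * (6 * m + 27) + 10) + 2)
        (RoundInv n m W Z g sg ω (i + min d q) (q - min d q)) := by
  induction d with
  | zero =>
    intro i q s _ hs
    exact Wp.block (by simp) trivial (by simpa using hs)
  | succ d ih =>
    intro i q s hM hs
    obtain _ | q := q
    · refine Wp.ite_le (t := 0) (by omega) (fun h => absurd hs.levels h) fun _ => ?_
      exact Wp.block (by simp) trivial (by simpa using hs)
    · rw [Nat.add_min_add_right]
      refine Wp.ite_le (t := (n * (6 * m + 27) + 8) + (min d q * (n * (6 * m + 27) + 10) + 2))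
        (by rw [Nat.succ_mul (min d q)]; omega) (fun _ => Wp.seq ?_) fun h => ?_
      · refine (round_spec (l := i + (q + 1)) (by omega) hg hZ hW hM hs).mono le_rfl fun s' hs' => ?_
        have := ih (i := i + 1) (by rwa [show i + 1 + q + 1 = i + (q + 1) + 1 by ring]) hs'
        rwa [show i + 1 + min d q = i + (min d q + 1) by ring,
          show q - min d q = q + 1 - (min d q + 1) by omega] at this
      · rw [hs.levels] at h
        omega

end

end RAM

/-! ### The word-problem program, its running time and its error probability -/

namespace RAM

attribute [local simp] evalAll okAll Op.eval Op.ok St.set St.setArr Function.update_apply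

/-- Computes the parameters of the rounds: the least `ell` with `len < 2 ^ ell`, and then
`coinCount = 4 * ell` and `shift = 2 * 2 ^ (5 * ell)`. -/
def params : Cmd :=
  .seq (.block [.const .pow 1, .const .ell 0, .copy .flag .len])
    (.seq (.loop .flag (.block [.add .pow .pow .pow, .add .ell .ell .one, .add .flag .len .one,
        .sub .flag .flag .pow]))
      (.block [.add .coinCount .ell .ell, .add .coinCount .coinCount .coinCount,
        .mul .val .pow .pow, .mul .val .val .val, .mul .shift .val .pow, .add .shift .shift .shift,
        .add .stride .nodes .one, .const .base 0, .copy .levels .ell]))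

/-- Compares the labels of the whole word and of the empty prefix; `val` becomes zero if and only if
they are equal. -/
def compareEnds : Cmd :=
  .block [.const .pos 0, .get .old .label .pos, .get .new .label .len, .sub .val .old .new,
    .sub .src .new .old, .add .val .val .src]

/-- The program for the word problem in the free solvable group of class `d`, where `k` bits encode
a generator. -/
def wordProblem (k d : ℕ) : Cmd :=
  .seq (readWord k) (.seq params (.seq (rounds d) compareEnds))

theorem params_spec {r : ℕ} {L : List (Fin r × Bool)} {ω : ℕ → Bool} {s : St} {M ell : ℕ}
    (hell : ell = Nat.clog 2 (L.length + 1))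
    (hM : 2 * 2 ^ (5 * ell) * (ell + 1) * (s.v .nodes + 1) ≤ M) (hs : ReadInv L ω L.length s) :
    Wp M params s (6 * ell + 13) (RoundInv L.length (4 * ell) (2 ^ (5 * ell)) (s.v .nodes + 1)
      (s.a .letter) (fun j => decide (s.a .sign j ≠ 0)) ω 0 ell) := by
  have hM0 : 2 * 2 ^ (5 * ell) * (ell + 1) ≤ M := (Nat.le_mul_of_pos_right _ (by omega)).trans hM
  have hM1 : 2 * 2 ^ (5 * ell) ≤ M := (Nat.le_mul_of_pos_right _ (by omega)).trans hM0
  have hMnodes : s.v .nodes + 1 ≤ M := (Nat.le_mul_of_pos_left _ (by positivity)).trans hM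
  have hp : ∀ c, c ≤ 5 → 2 ^ (c * ell) ≤ 2 ^ (5 * ell) := fun c hc =>
    Nat.pow_le_pow_right (by norm_num) (Nat.mul_le_mul_right _ hc)
  have hn : L.length + 1 ≤ 2 ^ ell := hell ▸ Nat.le_pow_clog (by norm_num) _
  have hell_lt : ell < 2 ^ ell := Nat.lt_two_pow_self
  have hp1 := hp 1 (by norm_num)
  have hp2 := hp 2 (by norm_num)
  have hp4 := hp 4 (by norm_num)
  rw [one_mul] at hp1
  refine Wp.seq_le (t := 3) (t' := 6 * ell + 10) (by omega) (Wp.block (by simp) ?_ ?_)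
  · simp; omega
  refine Wp.seq_le (t := ell * 6 + 1) (t' := 9) (by omega)
    ((Wp.loop (t := 4) ell (fun k s' => s'.v .pow = 2 ^ k ∧ s'.v .ell = k ∧
      s'.v .flag = L.length + 1 - 2 ^ k ∧ s'.v .len = L.length ∧ s'.v .one = 1 ∧
      s'.v .nodes = s.v .nodes ∧ s'.a = s.a ∧ s'.coins = s.coins) ?_ ?_ ?_).mono le_rfl ?_)
  · rintro k hk s' ⟨h1, h2, h3, h4, h5, h6, h7, h8⟩
    have hlt : 2 ^ k < L.length + 1 := (Nat.lt_clog_iff_pow_lt (by norm_num)).1 (hell ▸ hk)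
    have hle : 2 ^ (k + 1) ≤ 2 ^ ell := Nat.pow_le_pow_right (by norm_num) hk
    rw [pow_succ] at hle
    refine ⟨by omega, Wp.block (by simp) ?_ ?_⟩
    · simp [h1, h2, h4, h5]; omega
    · simp [h1, h2, h4, h5, h6, h7, h8, pow_succ, mul_two]
  · rintro s' ⟨-, -, h3, -⟩
    omega
  · simp [hs.len, hs.one]
  · rintro s' ⟨h1, h2, h3, h4, h5, h6, h7, h8⟩
    have e2 : 2 ^ ell * 2 ^ ell = 2 ^ (2 * ell) := by rw [← pow_add]; congr 1; omega
    have e4 : 2 ^ (2 * ell) * 2 ^ (2 * ell) = 2 ^ (4 * ell) := by rw [← pow_add]; congr 1; omega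
    have e5 : 2 ^ (4 * ell) * 2 ^ ell = 2 ^ (5 * ell) := by rw [← pow_add]; congr 1; omega
    have hell4 : 4 * ell ≤ M := by
      have h5 : 5 * ell < 2 ^ (5 * ell) := Nat.lt_two_pow_self
      omega
    refine Wp.block (by simp) ?_ ?_
    · simp [h1, h2, h5, h6, e2, e4, e5]; omega
    · refine ⟨⟨?_, ?_, ?_, ?_, ?_, ?_, ?_⟩, ?_, ?_, ?_, ?_, ?_⟩
      · simp [h5]
      · simp [h4]
      · simp [h2]; omega
      · simp [h1, e2, e4, e5]; omega
      · simp [h6, h5]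
      · simp [h7]
      · simp [h7]
      · simp
      · simp [h2]
      · simp [h7, hs.label, labels]
      · simp [h8, hs.coins]
      · simp [h7, hs.table]

theorem compareEnds_spec {n m W Z : ℕ} {g : ℕ → ℕ} {sg : ℕ → Bool} {ω : ℕ → Bool} {M i q : ℕ}
    {s : St} (hW : n * 2 ^ m ≤ W) (hM : 2 * W * (i + 1) ≤ M)
    (hs : RoundInv n m W Z g sg ω i q s) :
    Wp M compareEnds s 6 fun s' => s'.v .val = 0 ↔
      labels n m W Z g sg ω i n = labels n m W Z g sg ω i 0 := by
  have h0 := (labels_bounds (m := m) (W := W) (Z := Z) (g := g) (sg := sg) (ω := ω)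
    (Nat.zero_le n) i).2
  have hn := (labels_bounds (m := m) (W := W) (Z := Z) (g := g) (sg := sg) (ω := ω)
    (le_refl n) i).2
  have e : 2 * W * (i + 1) = 2 * W * i + 2 * W := by ring
  refine Wp.block (by simp) ?_ ?_
  · simp [hs.len, hs.label 0 (Nat.zero_le n), hs.label n le_rfl]; omega
  · simp [hs.len, hs.label 0 (Nat.zero_le n), hs.label n le_rfl]; omega

/-- A bound for the number of steps of the word-problem program on words of length `n`. -/
def stepBound (n k ell : ℕ) : ℕ :=
  (4 + (n * (6 + 10 * k + 2) + 1)) + ((6 * ell + 13) + ((ell * (n * (6 * (4 * ell) + 27) + 10) + 2) + 6))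

/-- A bound for the values that occur in the word-problem program. -/
def valueBound (n k ell : ℕ) : ℕ := 2 * 2 ^ (5 * ell) * (ell + 1) * (2 * (n * (k + 1) + 1))

theorem succ_mul_pow_le {n ell : ℕ} (hell : ell = Nat.clog 2 (n + 1)) :
    (n + 1) * 2 ^ (4 * ell) ≤ 2 ^ (5 * ell) := by
  have hn : n + 1 ≤ 2 ^ ell := hell ▸ Nat.le_pow_clog (by norm_num) _
  calc (n + 1) * 2 ^ (4 * ell) ≤ 2 ^ ell * 2 ^ (4 * ell) := Nat.mul_le_mul_right _ hn
    _ = 2 ^ (5 * ell) := by rw [← pow_add]; congr 1; omega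

theorem wordProblem_spec {r : ℕ} (L : List (Fin r × Bool)) (ω : ℕ → Bool) (d : ℕ) {ell : ℕ}
    (hell : ell = Nat.clog 2 (L.length + 1)) :
    Wp (valueBound L.length (Nat.clog 2 r) ell) (wordProblem (Nat.clog 2 r) d)
      (St.start (L.flatMap letterCode) ω) (stepBound L.length (Nat.clog 2 r) ell) fun s =>
        ∃ Z g sg, Describes L Z g sg ∧ (s.v .val = 0 ↔
          labels L.length (4 * ell) (2 ^ (5 * ell)) Z g sg ω (min d ell) L.length =
            labels L.length (4 * ell) (2 ^ (5 * ell)) Z g sg ω (min d ell) 0) := by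
  set k := Nat.clog 2 r with hk
  have hW := succ_mul_pow_le hell
  have hWn : L.length * 2 ^ (4 * ell) ≤ 2 ^ (5 * ell) :=
    (Nat.mul_le_mul_right _ (Nat.le_succ _)).trans hW
  have hfac : 1 ≤ 2 * 2 ^ (5 * ell) * (ell + 1) := Nat.succ_le_of_lt (by positivity)
  refine Wp.seq ((readWord_spec L ω ?_).mono le_rfl fun s hs => ?_)
  · rw [← hk, valueBound]
    calc 2 * (L.length * (k + 1)) + 2 = 1 * (2 * (L.length * (k + 1) + 1)) := by ring
      _ ≤ _ := Nat.mul_le_mul_right _ hfac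
  have hnodes : s.v .nodes + 1 ≤ 2 * (L.length * (k + 1) + 1) := by
    have h1 := hs.nodes
    have h2 : L.length * (k + 1) = L.length * k + L.length := by ring
    rw [← hk] at h1
    omega
  have hM : 2 * 2 ^ (5 * ell) * (ell + 1) * (s.v .nodes + 1) ≤ valueBound L.length k ell :=
    Nat.mul_le_mul_left _ hnodes
  have hd := hs.describes
  refine Wp.seq ((params_spec hell hM hs).mono le_rfl fun s₁ hs₁ => ?_)
  have hmin : min d ell * (L.length * (6 * (4 * ell) + 27) + 10) ≤
      ell * (L.length * (6 * (4 * ell) + 27) + 10) := Nat.mul_le_mul_right _ (min_le_right _ _)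
  refine Wp.seq ((rounds_spec hd.lt (Nat.le_add_left 1 _) hW d (by rwa [zero_add]) hs₁).mono
    (by omega) fun s₂ hs₂ => ?_)
  rw [zero_add] at hs₂
  refine (compareEnds_spec hWn ?_ hs₂).mono le_rfl fun s₃ hs₃ => ⟨_, _, _, hd, hs₃⟩
  refine le_trans ?_ ((Nat.le_mul_of_pos_right _ (Nat.succ_pos _)).trans hM)
  exact Nat.mul_le_mul_left _ (by omega)

theorem length_flatMap_letterCode {r : ℕ} (L : List (Fin r × Bool)) :
    (L.flatMap letterCode).length = L.length * (Nat.clog 2 r + 1) := by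
  induction L with
  | nil => simp
  | cons a L ih => rw [List.flatMap_cons, List.length_append, ih]; simp [letterCode]; ring

theorem opCost_valueBound_le {n k ell lam : ℕ} (hn : n * (k + 1) + 1 < 2 ^ (lam + 1))
    (hlam : 1 ≤ lam) (hell : ell ≤ 2 * lam) : opCost (valueBound n k ell) ≤ 12500 * lam ^ 2 := by
  have hsize : (valueBound n k ell).size ≤ 16 * lam := by
    rw [Nat.size_le, valueBound]
    have h1 : 2 ^ (5 * ell) ≤ 2 ^ (10 * lam) := Nat.pow_le_pow_right (by norm_num) (by omega)
    have h2 : ell + 1 ≤ 2 ^ (2 * lam) :=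
      (Nat.succ_le_succ hell).trans (Nat.succ_le_of_lt Nat.lt_two_pow_self)
    have h3 : 2 ^ (lam + 1) ≤ 2 ^ (2 * lam) := Nat.pow_le_pow_right (by norm_num) (by omega)
    have h4 : 2 ^ 2 ≤ 2 ^ (2 * lam) := Nat.pow_le_pow_right (by norm_num) (by omega)
    calc 2 * 2 ^ (5 * ell) * (ell + 1) * (2 * (n * (k + 1) + 1))
        = (2 ^ 2 * (2 ^ (5 * ell) * (ell + 1))) * (n * (k + 1) + 1) := by ring
      _ < (2 ^ 2 * (2 ^ (5 * ell) * (ell + 1))) * 2 ^ (2 * lam) :=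
          Nat.mul_lt_mul_of_pos_left (hn.trans_le h3) (by positivity)
      _ ≤ (2 ^ (2 * lam) * (2 ^ (10 * lam) * 2 ^ (2 * lam))) * 2 ^ (2 * lam) := by gcongr
      _ = 2 ^ (16 * lam) := by rw [← pow_add, ← pow_add, ← pow_add]; congr 1; omega
  rw [opCost]
  have : (valueBound n k ell).size + 9 ≤ 25 * lam := by omega
  calc 20 * ((valueBound n k ell).size + 9) ^ 2 ≤ 20 * (25 * lam) ^ 2 := by gcongr
    _ = 12500 * lam ^ 2 := by ring

theorem stepBound_le {n k ell lam : ℕ} (hlam : 1 ≤ lam) (hell : ell ≤ 2 * lam) :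
    stepBound n k ell + 2 ≤ 160 * (n * (k + 1) + 1) * lam ^ 2 := by
  have h1 : ell * (n * (6 * (4 * ell) + 27) + 10) ≤
      2 * lam * (n * (75 * lam) + 10) := by
    have : 6 * (4 * ell) + 27 ≤ 75 * lam := by omega
    gcongr
  have h2 : lam ≤ lam ^ 2 := Nat.le_self_pow (by norm_num) _
  have h3 : n ≤ n * (k + 1) := Nat.le_mul_of_pos_right _ (Nat.succ_pos _)
  have h4 : n * lam ^ 2 ≤ n * (k + 1) * lam ^ 2 := Nat.mul_le_mul_right _ h3
  have h5 : n * (k + 1) ≤ n * (k + 1) * lam ^ 2 := Nat.le_mul_of_pos_right _ (by positivity)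
  have h6 : n * (6 + 10 * k + 2) ≤ 10 * (n * (k + 1)) := by nlinarith
  rw [stepBound]
  nlinarith

/-- The cost of the program is quasi-linear in the length of the code of the word. -/
theorem cost_le {n k ell : ℕ} (hell : ell = Nat.clog 2 (n + 1)) :
    (stepBound n k ell + 2) * opCost (valueBound n k ell) ≤
      quasiLinear 2000000 4 (n * (k + 1)) := by
  set lam := Nat.log 2 (n * (k + 1) + 2) with hlamdef
  have hlam : 1 ≤ lam := Nat.log_pos (by norm_num) (by omega)
  have hlt : n * (k + 1) + 2 < 2 ^ (lam + 1) := Nat.lt_pow_succ_log_self (by norm_num) _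
  have h3 : n ≤ n * (k + 1) := Nat.le_mul_of_pos_right _ (Nat.succ_pos _)
  have hell' : ell ≤ 2 * lam := by
    have : ell ≤ lam + 1 := hell ▸ Nat.clog_le_of_le_pow (by omega)
    omega
  calc (stepBound n k ell + 2) * opCost (valueBound n k ell)
      ≤ (160 * (n * (k + 1) + 1) * lam ^ 2) * (12500 * lam ^ 2) :=
        Nat.mul_le_mul (stepBound_le hlam hell') (opCost_valueBound_le (by omega) hlam hell')
    _ = quasiLinear 2000000 4 (n * (k + 1)) := by rw [quasiLinear, ← hlamdef]; ring

theorem quasiLinear_mono {C C' k k' n : ℕ} (hC : C ≤ C') (hk : k ≤ k') :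
    quasiLinear C k n ≤ quasiLinear C' k' n := by
  have : 0 < Nat.log 2 (n + 2) := Nat.log_pos (by norm_num) (by omega)
  rw [quasiLinear, quasiLinear]
  gcongr

/-- If the rank is at most the length of the word, then a generator is encoded by `O(log n)` bits,
so that the cost is also quasi-linear in the length of the word. -/
theorem quasiLinear_code_le {n r : ℕ} (hr : r ≤ n) :
    quasiLinear 2000000 4 (n * (Nat.clog 2 r + 1)) ≤ quasiLinear 8000000000 5 n := by
  set mu := Nat.log 2 (n + 2) with hmu
  set N := n * (Nat.clog 2 r + 1) with hN
  have hmu1 : 1 ≤ mu := Nat.log_pos (by norm_num) (by omega)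
  have hlt : n + 2 < 2 ^ (mu + 1) := Nat.lt_pow_succ_log_self (by norm_num) _
  have hk : Nat.clog 2 r + 1 ≤ 3 * mu := by
    have : Nat.clog 2 r ≤ mu + 1 := Nat.clog_le_of_le_pow (by omega)
    omega
  have hNle : N + 1 ≤ 3 * mu * (n + 1) := by nlinarith
  have hmu2 : mu ≤ n + 2 := Nat.log_le_self _ _
  have hlog : Nat.log 2 (N + 2) ≤ 6 * mu := by
    have h1 : N + 2 < 2 ^ (2 * mu + 4) := by
      calc N + 2 ≤ 3 * mu * (n + 1) + 1 := by omega
        _ ≤ 4 * ((n + 2) * (n + 2)) := by nlinarith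
        _ < 4 * (2 ^ (mu + 1) * 2 ^ (mu + 1)) := by
          have := Nat.mul_lt_mul'' hlt hlt
          omega
        _ = 2 ^ (2 * mu + 4) := by ring
    have := Nat.log_lt_of_lt_pow (by omega) h1
    omega
  calc 2000000 * (N + 1) * Nat.log 2 (N + 2) ^ 4
      ≤ 2000000 * (3 * mu * (n + 1)) * (6 * mu) ^ 4 := by gcongr
    _ = 7776000000 * (n + 1) * mu ^ 5 := by ring
    _ ≤ 8000000000 * (n + 1) * mu ^ 5 := by gcongr; norm_num

/-- The union bound beats the required success probability for words of length at least two. -/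
theorem rpow_le_of_two_le {n ell l : ℕ} (hn : 2 ≤ n) (hell : n + 1 ≤ 2 ^ ell) (hl : l ≤ ell) :
    (1 - 1 / (n : ℝ)) ^ Real.logb 3 n ≤
      1 - l * (n + 1 : ℝ) ^ 2 * ((2 : ℝ) ^ (4 * ell))⁻¹ := by
  have h2n : (2 : ℝ) ≤ n := by exact_mod_cast hn
  have hE : (n + 1 : ℝ) ≤ 2 ^ ell := by exact_mod_cast hell
  have hl2 : (2 * l : ℝ) ≤ 2 ^ ell := by
    have : 2 * ell ≤ 2 ^ ell := by
      obtain _ | e := ell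
      · simp
      · rw [pow_succ]
        have : e < 2 ^ e := Nat.lt_two_pow_self
        omega
    calc (2 * l : ℝ) ≤ 2 * ell := by exact_mod_cast Nat.mul_le_mul_left 2 hl
      _ ≤ 2 ^ ell := by exact_mod_cast this
  have herr : l * (n + 1 : ℝ) ^ 2 * ((2 : ℝ) ^ (4 * ell))⁻¹ ≤ 1 / (2 * (n + 1)) := by
    rw [← div_eq_mul_inv, div_le_div_iff₀ (by positivity) (by positivity), one_mul]
    calc l * (n + 1 : ℝ) ^ 2 * (2 * (n + 1)) = (2 * l) * ((n + 1) * ((n + 1) * (n + 1))) := by ring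
      _ ≤ 2 ^ ell * (2 ^ ell * (2 ^ ell * 2 ^ ell)) := by gcongr
      _ = (2 : ℝ) ^ (4 * ell) := by rw [← pow_add, ← pow_add, ← pow_add]; congr 1; omega
  have hbase1 : 1 - 1 / (n : ℝ) ≤ 1 := by
    have : 0 ≤ 1 / (n : ℝ) := by positivity
    linarith
  have hbasepos : 0 < 1 - 1 / (n : ℝ) := by
    rw [sub_pos, div_lt_one (by linarith)]; linarith
  refine le_trans ?_ (sub_le_sub_left herr 1)
  obtain rfl | h3 := hn.eq_or_lt
  · -- here the exponent is `log 2 / log 3 ≥ 1 / 2`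
    have hlog : (1 / 2 : ℝ) ≤ Real.logb 3 (2 : ℕ) := by
      rw [Real.le_logb_iff_rpow_le (by norm_num) (by norm_num), ← Real.sqrt_eq_rpow,
        Real.sqrt_le_left (by norm_num)]
      norm_num
    refine (Real.rpow_le_rpow_of_exponent_ge hbasepos hbase1 hlog).trans ?_
    rw [← Real.sqrt_eq_rpow, Real.sqrt_le_left (by norm_num)]
    norm_num
  · have h3n : (3 : ℝ) ≤ n := by exact_mod_cast h3
    have hlog : (1 : ℝ) ≤ Real.logb 3 n := by
      rw [Real.le_logb_iff_rpow_le (by norm_num) (by linarith), Real.rpow_one]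
      exact h3n
    refine (Real.rpow_le_rpow_of_exponent_ge hbasepos hbase1 hlog).trans ?_
    rw [Real.rpow_one]
    refine sub_le_sub_left (one_div_le_one_div_of_le (by linarith) (by linarith)) 1

/-- On words of length one, every choice of the random bits separates the two prefixes. -/
theorem labels_one_ne {m W Z : ℕ} {g : ℕ → ℕ} {sg : ℕ → Bool} (hW : 2 ^ m ≤ W) (ω : ℕ → Bool)
    (i : ℕ) : labels 1 m W Z g sg ω (i + 1) 1 ≠ labels 1 m W Z g sg ω (i + 1) 0 := by
  have hlt : blockVal m ω (i * 1 + firstKey Z g sg (labels 1 m W Z g sg ω i) 0) < 2 ^ m :=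
    bitsVal_lt _ _
  have hB : W ≤ 2 * W * (i + 1) := by nlinarith
  simp only [labels, newLabel]
  split_ifs <;> omega

end RAM

theorem mainTheorem2 :
    ∃ C k : ℕ, ∀ r d : ℕ, ∃ P : RAM.Program, ∀ w : FreeGroup (Fin r),
      (∀ ω : ℕ → Bool,
        RAM.RunsInTime P (wordCode w) ω (quasiLinear C k (wordCode w).length) ∧
        (r ≤ w.norm → RAM.RunsInTime P (wordCode w) ω (quasiLinear C k w.norm))) ∧
      ((w : FreeSolvableGroup r d) = 1 →
        ∀ ω : ℕ → Bool, RAM.Answers P (wordCode w) ω true) ∧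
      ((w : FreeSolvableGroup r d) ≠ 1 →
        (1 - 1 / (w.norm : ℝ)) ^ Real.logb 3 (w.norm : ℝ) ≤
          RAM.coinMeasure.real {ω | RAM.Answers P (wordCode w) ω false}) := by
  -- the exponent is `5`: two factors `log` for the steps, two for the cost of a step, and one for
  -- the length of the code of a generator
  refine ⟨8000000000, 5, fun r d => ⟨(RAM.wordProblem (Nat.clog 2 r) d).program .val, fun w => ?_⟩⟩
  set L := w.toWord with hL
  have hmk : FreeGroup.mk L = w := FreeGroup.mk_toWord
  have hnorm : w.norm = L.length := rfl
  have hcode : wordCode w = L.flatMap letterCode := rfl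
  obtain ⟨ell, hell⟩ : ∃ ell, ell = Nat.clog 2 (L.length + 1) := ⟨_, rfl⟩
  have hpow : L.length + 1 ≤ 2 ^ ell := hell ▸ Nat.le_pow_clog (by norm_num) _
  have hW : L.length * 2 ^ (4 * ell) ≤ 2 ^ (5 * ell) :=
    (Nat.mul_le_mul_right _ (Nat.le_succ _)).trans (RAM.succ_mul_pow_le hell)
  have hM : 2 ≤ RAM.valueBound L.length (Nat.clog 2 r) ell := by
    have : 1 ≤ 2 ^ (5 * ell) * (ell + 1) * (2 * (L.length * (Nat.clog 2 r + 1) + 1)) :=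
      Nat.succ_le_of_lt (by positivity)
    rw [RAM.valueBound, mul_assoc 2, mul_assoc 2]
    omega
  -- the letter numbers of one run serve for all runs, because they do not affect the labels
  obtain ⟨Z, g, sg, hd⟩ : ∃ Z g sg, RAM.Describes L Z g sg := by
    obtain ⟨_, _, _, _, Z, g, sg, hd, -⟩ := RAM.wordProblem_spec L (fun _ => false) d hell
    exact ⟨Z, g, sg, hd⟩
  let lab : (ℕ → Bool) → ℕ → ℕ := fun ω =>
    RAM.labels L.length (4 * ell) (2 ^ (5 * ell)) Z g sg ω (min d ell)
  have hrun : ∀ ω, ∃ t ≤ (RAM.stepBound L.length (Nat.clog 2 r) ell + 2) *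
      RAM.opCost (RAM.valueBound L.length (Nat.clog 2 r) ell),
      RAM.Halts ((RAM.wordProblem (Nat.clog 2 r) d).program .val) (RAM.init (wordCode w) ω)
        (decide (lab ω L.length = lab ω 0)) t := by
    intro ω
    obtain ⟨t, ht, s, hexec, Z', g', sg', hd', hval⟩ := RAM.wordProblem_spec L ω d hell
    obtain ⟨u, hu, hhalt⟩ := hexec.halts hM .val
    refine ⟨u, hu.trans (Nat.mul_le_mul_right _ (by omega)), ?_⟩
    rw [hd'.labels_congr hd ω _ _ le_rfl, hd'.labels_congr hd ω _ _ (Nat.zero_le _)] at hval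
    rwa [decide_eq_decide.2 hval] at hhalt
  have hcost : (RAM.stepBound L.length (Nat.clog 2 r) ell + 2) *
      RAM.opCost (RAM.valueBound L.length (Nat.clog 2 r) ell) ≤
        quasiLinear 2000000 4 (L.length * (Nat.clog 2 r + 1)) := RAM.cost_le hell
  refine ⟨fun ω => ?_, fun hw ω => ?_, fun hw => ?_⟩
  · obtain ⟨t, ht, hhalt⟩ := hrun ω
    refine ⟨⟨_, t, ?_, hhalt⟩, fun hr => ⟨_, t, ?_, hhalt⟩⟩
    · rw [hcode, RAM.length_flatMap_letterCode]
      exact (ht.trans hcost).trans (RAM.quasiLinear_mono (by norm_num) (by norm_num))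
    · exact (ht.trans hcost).trans (RAM.quasiLinear_code_le hr)
  · obtain ⟨t, -, hhalt⟩ := hrun ω
    refine ⟨t, ?_⟩
    rw [QuotientGroup.eq_one_iff] at hw
    have hw' := derivedSeries_antitone (FreeGroup (Fin r)) (min_le_left d ell) hw
    have heq : lab ω L.length = lab ω 0 := by
      refine hd.labels_eq hW ω _ _ le_rfl _ (Nat.zero_le _) ?_
      rw [List.take_length, List.take_zero, hmk, ← FreeGroup.one_eq_mk, QuotientGroup.eq, mul_one]
      exact Subgroup.inv_mem _ hw'
    rwa [decide_eq_true heq] at hhalt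
  · rw [ne_eq, QuotientGroup.eq_one_iff] at hw
    have hsub : {ω | lab ω L.length ≠ lab ω 0} ⊆
        {ω | RAM.Answers ((RAM.wordProblem (Nat.clog 2 r) d).program .val) (wordCode w) ω false} := by
      intro ω hω
      obtain ⟨t, -, hhalt⟩ := hrun ω
      rw [decide_eq_false hω] at hhalt
      exact ⟨t, hhalt⟩
    have hne : L ≠ [] := by
      intro h0
      apply hw
      rw [← hmk, h0, ← FreeGroup.one_eq_mk]
      exact Subgroup.one_mem _
    have hlen : 1 ≤ L.length := List.length_pos_iff.2 hne
    -- nontrivial elements of the `ell`-th derived subgroup are longer than `w`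
    have hw' : FreeGroup.mk L ∉ derivedSeries (FreeGroup (Fin r)) (min d ell) := by
      rcases min_choice d ell with h | h
      · rw [h, hmk]; exact hw
      · rw [h]
        intro hmem
        have := FreeGroup.two_pow_le_length ell (L := L) FreeGroup.isReduced_toWord hne hmem
        omega
    refine le_trans ?_ (measureReal_mono hsub)
    rw [hnorm]
    obtain h1 | h2 := hlen.eq_or_lt
    · have hd1 : min d ell ≠ 0 := by
        intro h0
        rw [h0] at hw'
        exact hw' (Subgroup.mem_top _)
      obtain ⟨i, hi⟩ := Nat.exists_eq_succ_of_ne_zero hd1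
      have huniv : {ω | lab ω L.length ≠ lab ω 0} = Set.univ := by
        refine Set.eq_univ_of_forall fun ω => ?_
        change RAM.labels L.length (4 * ell) (2 ^ (5 * ell)) Z g sg ω (min d ell) L.length ≠
          RAM.labels L.length (4 * ell) (2 ^ (5 * ell)) Z g sg ω (min d ell) 0
        rw [← h1, hi]
        exact RAM.labels_one_ne (by rwa [← h1, one_mul] at hW) ω i
      rw [huniv, ← h1]
      simp
    · exact (RAM.rpow_le_of_two_le h2 hpow (min_le_right d ell)).trans (hd.le_coinMeasure hW _ hw')
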